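/- Let $0<q<1$, and write $(a;q)_n=\prod_{k=0}^{n-1}(1-aq^k)$ for $n=0,1,\dots,\infty$ and $(a_1,\dots,a_r;q)_n=\prod_{j}(a_j;q)_n$. Let $h_0(x|q)=1$, $h_1(x|q)=2x$, $h_{n+1}(x|q)=2xh_n(x|q)-q^{-n}(1-q^n)h_{n-1}(x|q)$ $(n\ge 1)$ be the $q^{-1}$-Hermite polynomials, and let $\mu$ be a solution of their moment problem, i.e. a probability measure on $\mathbb R$ with finite moments of all orders such that $\int h_mh_n\,d\mu=q^{-n(n+1)/2}(q;q)_n\delta_{m,n}$ for all $m,n\ge0$. For $t\in\mathbb C$ and $x=\sinh\xi\in\mathbb R$ ($\xi\in\mathbb R$) put $\chi_t(x)=(-te^{\xi},te^{-\xi};q)_\infty$ and $$\varphi_n(x;t_1,t_2,t_3,t_4)={}_4\phi_3\left(\begin{matrix}q^{-n},\,-t_1t_2q^{n-2},\,-t_1t_3/q,\,-t_1t_4/q\\ -t_1e^{\xi},\ t_1e^{-\xi},\ t_1t_2t_3t_4q^{-3}\end{matrix}\;\middle|\;q,q\right),\qquad \varphi_n(x;t_1,t_2)={}_3\phi_2\left(\begin{matrix}q^{-n},\,-t_1t_2q^{n-2},\,0\\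 -t_1e^{\xi},\ t_1e^{-\xi}\end{matrix}\;\middle|\;q,q\right).$$ (a) Let $t_1,t_2,t_3,t_4\in\mathbb C$ satisfy $|t_1t_3|<q^{3/2}$ and $|t_2t_4|<q^{3/2}$, and put $T=t_1t_2t_3t_4q^{-3}$. Then for all integers $m,n\ge0$ the function $\varphi_m(x;t_1,t_2,t_3,t_4)\,\varphi_n(x;t_2,t_1,t_3,t_4)\prod_{i=1}^4\chi_{t_i}(x)$, extended by continuity to the finitely many real zeros of $(-t_1e^{\xi},t_1e^{-\xi};q)_m\,(-t_2e^{\xi},t_2e^{-\xi};q)_n$, is continuous on $\mathbb R$ and $\mu$-integrable, and $$\int_{\mathbb R}\varphi_m(x;t_1,t_2,t_3,t_4)\,\varphi_n(x;t_2,t_1,t_3,t_4)\prod_{i=1}^4\chi_{t_i}(x)\,d\mu(x)=K_n\,\delta_{m,n},$$ where $$K_n=\frac{(q;q)_n\,\prod_{k=0}^{n-1}\bigl(T+t_1t_2q^{k-1}\bigr)\,(-t_1t_2q^{n-2};q)_n\,(-t_1t_2q^{2n-1};q)_\infty}{(T;q)_n}\cdot\frac{(-t_1t_3/q,-t_1t_4/q,-t_2t_3/q,-t_2t_4/q,-t_3t_4/q;q)_\infty}{(T;q)_\infty}.$$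 If $t_3t_4\ne0$ and $1+t_1t_2q^{2n-2}\neq0$, then $$K_n=\frac{1+t_1t_2q^{n-2}}{1+t_1t_2q^{2n-2}}\cdot\frac{T^n\,(q,-q^2/(t_3t_4);q)_n\,(-t_1t_2q^{n-1};q)_\infty}{(T;q)_n}\cdot\frac{(-t_1t_3/q,-t_1t_4/q,-t_2t_3/q,-t_2t_4/q,-t_3t_4/q;q)_\infty}{(T;q)_\infty}.$$ (b) Let $t_1,t_2\in\mathbb C$ be arbitrary. Then $\varphi_n(x;t_1,t_2,0,0)=\varphi_n(x;t_1,t_2)$, and for all integers $m,n\ge0$, with the integrand extended by continuity and integrable as in (a), $$\int_{\mathbb R}\varphi_m(x;t_1,t_2)\,\varphi_n(x;t_2,t_1)\,\chi_{t_1}(x)\chi_{t_2}(x)\,d\mu(x)=K_n^0\,\delta_{m,n},$$ where $K_n^0$ is $K_n$ with $t_3=t_4=0$; if $1+t_1t_2q^{2n-2}\ne0$, then $$K_n^0=\frac{1+t_1t_2q^{n-2}}{1+t_1t_2q^{2n-2}}\,(-t_1t_2q^{n-1};q)_\infty\,(q;q)_n\,q^{n(n-3)/2}\,(t_1t_2)^n.$$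 -/

import Mathlib

open MeasureTheory

noncomputable section

namespace QInvHermite

/-- The `q`-shifted factorial `(a; q)_n = ∏_{k=0}^{n-1} (1 - a q^k)`. -/
def qPoch {R : Type*} [CommRing R] (a q : R) (n : ℕ) : R :=
  ∏ k ∈ Finset.range n, (1 - a * q ^ k)

/-- The infinite `q`-shifted factorial `(a; q)_∞ = ∏_{k=0}^∞ (1 - a q^k)`. -/
def qPochInf (a q : ℂ) : ℂ := ∏' k : ℕ, (1 - a * q ^ k)

/-- For `|q| < 1` the product defining `(a; q)_∞` converges absolutely. -/
theorem multipliable_qPochInf (a q : ℂ) (hq : ‖q‖ < 1) :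
    Multipliable fun k : ℕ => (1 - a * q ^ k) := by
  have hs : Summable fun k : ℕ => ‖-(a * q ^ k)‖ := by
    have h := (summable_geometric_of_lt_one (norm_nonneg q) hq).mul_left ‖a‖
    simpa [norm_mul, norm_pow] using h
  simpa [sub_eq_add_neg] using multipliable_one_add_of_summable hs

/-- The basic hypergeometric series `_rφ_s(a_1, …, a_r; b_1, …, b_s; q, z)`, where `as` lists the
numerator parameters and `bs` the denominator parameters. -/
def basicHypergeometric (as bs : List ℂ) (q z : ℂ) : ℂ :=
  ∑' k : ℕ, (as.map fun a => qPoch a q k).prod /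
      (qPoch q q k * (bs.map fun b => qPoch b q k).prod) * z ^ k *
    ((-1) ^ k * q ^ (k * (k - 1) / 2)) ^ ((bs.length : ℤ) + 1 - (as.length : ℤ))

/-- The `q⁻¹`-Hermite polynomials `h_n(x | q)`, through their three term recurrence. -/
def qInvHermite (q x : ℝ) : ℕ → ℝ
  | 0 => 1
  | 1 => 2 * x
  | n + 2 => 2 * x * qInvHermite q x (n + 1)
      - (q ^ (n + 1))⁻¹ * (1 - q ^ (n + 1)) * qInvHermite q x n

/-- `μ` is a solution of the `q⁻¹`-Hermite moment problem: a probability measure on the line with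
moments of all orders for which the `h_n(x | q)` are orthogonal with squared norms
`q^{-n(n+1)/2} (q; q)_n`. -/
structure IsMomentSolution (q : ℝ) (μ : Measure ℝ) : Prop where
  isProbabilityMeasure : IsProbabilityMeasure μ
  integrable_pow : ∀ n : ℕ, Integrable (fun x : ℝ => x ^ n) μ
  integral_mul : ∀ m n : ℕ, ∫ x, qInvHermite q x m * qInvHermite q x n ∂μ =
    if m = n then (q ^ (n * (n + 1) / 2))⁻¹ * qPoch q q n else 0

/-- `e^ξ` for the real `ξ` with `x = sinh ξ`, so that `e^ξ = √(x² + 1) + x`. -/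
def expXi (x : ℝ) : ℂ := (Real.exp (Real.arsinh x) : ℝ)

/-- `e^{-ξ}` for the real `ξ` with `x = sinh ξ`, so that `e^{-ξ} = √(x² + 1) - x`. -/
def expNegXi (x : ℝ) : ℂ := (Real.exp (-Real.arsinh x) : ℝ)

/-- `χ_t(x) = (-t e^ξ, t e^{-ξ}; q)_∞`, `x = sinh ξ`. -/
def chi (q : ℝ) (t : ℂ) (x : ℝ) : ℂ :=
  qPochInf (-t * expXi x) q * qPochInf (t * expNegXi x) q

/-- The rational function `φ_n(x; t₁, t₂, t₃, t₄)`, a terminating `₄φ₃`. -/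
def phi4 (q : ℝ) (n : ℕ) (t₁ t₂ t₃ t₄ : ℂ) (x : ℝ) : ℂ :=
  basicHypergeometric
    [(q : ℂ) ^ (-(n : ℤ)), -t₁ * t₂ * (q : ℂ) ^ ((n : ℤ) - 2), -t₁ * t₃ / q, -t₁ * t₄ / q]
    [-t₁ * expXi x, t₁ * expNegXi x, t₁ * t₂ * t₃ * t₄ * (q : ℂ) ^ (-3 : ℤ)] q q

/-- The rational function `φ_n(x; t₁, t₂)`, a terminating `₃φ₂`. -/
def phi3 (q : ℝ) (n : ℕ) (t₁ t₂ : ℂ) (x : ℝ) : ℂ :=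
  basicHypergeometric
    [(q : ℂ) ^ (-(n : ℤ)), -t₁ * t₂ * (q : ℂ) ^ ((n : ℤ) - 2), 0]
    [-t₁ * expXi x, t₁ * expNegXi x] q q

/-- The real points at which a denominator `(-t e^ξ, t e^{-ξ}; q)_k`, `k ≤ n`, vanishes. -/
def poles (q : ℝ) (n : ℕ) (t : ℂ) : Set ℝ :=
  {x | qPoch (-t * expXi x) (q : ℂ) n * qPoch (t * expNegXi x) (q : ℂ) n = 0}

/-- `∫ f dμ = c`, where `f` is given by its formula off the finite set `Z` of removable
singularities and by continuity on `Z`: `f` extends from the complement of `Z` to a continuous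
function (a unique one, as `Z` is finite), which is `μ`-integrable with integral `c`. -/
def HasExtendedIntegral (μ : Measure ℝ) (Z : Set ℝ) (f : ℝ → ℂ) (c : ℂ) : Prop :=
  Z.Finite ∧ ∃ F : ℝ → ℂ, Continuous F ∧ (∀ x, x ∉ Z → F x = f x) ∧
    Integrable F μ ∧ ∫ x, F x ∂μ = c

/-- When `Z` is a null set, the extension plays no role. -/
theorem HasExtendedIntegral.of_null {μ : Measure ℝ} {Z : Set ℝ} {f : ℝ → ℂ} {c : ℂ}
    (h : HasExtendedIntegral μ Z f c) (hZ : μ Z = 0) :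
    Integrable f μ ∧ ∫ x, f x ∂μ = c := by
  obtain ⟨-, F, -, hF, hi, hc⟩ := h
  have hae : F =ᵐ[μ] f := by
    filter_upwards [measure_eq_zero_iff_ae_notMem.mp hZ] with x hx using hF x hx
  exact ⟨hi.congr hae, by rw [← integral_congr_ae hae, hc]⟩

/-- The normalization constant, written without removable singularities:
`(q; q)_n ∏_{k<n} (t₁t₂t₃t₄q^{-3} + t₁t₂q^{k-1}) (-t₁t₂q^{n-2}; q)_n (-t₁t₂q^{2n-1}; q)_∞`
times
`(-t₁t₃/q, -t₁t₄/q, -t₂t₃/q, -t₂t₄/q, -t₃t₄/q; q)_∞`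
over `(t₁t₂t₃t₄q^{-3}; q)_n (t₁t₂t₃t₄q^{-3}; q)_∞`. -/
def normConst (q : ℝ) (n : ℕ) (t₁ t₂ t₃ t₄ : ℂ) : ℂ :=
  qPoch (q : ℂ) q n *
    (∏ k ∈ Finset.range n,
      (t₁ * t₂ * t₃ * t₄ * (q : ℂ) ^ (-3 : ℤ) + t₁ * t₂ * (q : ℂ) ^ ((k : ℤ) - 1))) *
    qPoch (-t₁ * t₂ * (q : ℂ) ^ ((n : ℤ) - 2)) q n *
    qPochInf (-t₁ * t₂ * (q : ℂ) ^ (2 * (n : ℤ) - 1)) q *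
    (qPochInf (-t₁ * t₃ / q) q * qPochInf (-t₁ * t₄ / q) q * qPochInf (-t₂ * t₃ / q) q *
      qPochInf (-t₂ * t₄ / q) q * qPochInf (-t₃ * t₄ / q) q) /
    (qPoch (t₁ * t₂ * t₃ * t₄ * (q : ℂ) ^ (-3 : ℤ)) q n *
      qPochInf (t₁ * t₂ * t₃ * t₄ * (q : ℂ) ^ (-3 : ℤ)) q)

end QInvHermite

end

/-!
The biorthogonality rests on one integral: for every solution `μ` of the moment problem,
`∫ ∏ χ_{tᵢ} dμ = ∏_{i<j} (-tᵢtⱼ/q; q)_∞ / (t₁t₂t₃t₄q⁻³; q)_∞`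
(`IsMomentSolution.integral_chi_mul`). Let `H_n(a, b)` be the coefficient of `z^n` in
`(-az, -bz; q)_∞` (`hermiteForm`) and `w_n = q^{-n(n-1)/2} (q; q)_n`, so that
`h_n(sinh ξ) = w_n H_n(e^ξ, -e^{-ξ})`. The bilinear generating function (`mehler_formula`)
`∑ w_n H_n(a, b) H_n(c, d) = (-ac, -ad, -bc, -bd; q)_∞ / (abcd/q; q)_∞`, `|abcd| < q`,
is used twice. With `c = e^ξ`, `d = -e^{-ξ}` it expands `χ_a χ_b` as the multiple
`(-ab/q; q)_∞ ∑ H_n(a, b) h_n` of a series in the polynomials `h_n`. For `|ab| < q^{3/2}` the norms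
of its terms in `L²(μ)` are summable, whatever the solution `μ` is. Hence the integral of the product
of `χ_{t₁} χ_{t₃}` and `χ_{t₂} χ_{t₄}` may be computed termwise; orthogonality leaves a multiple of
`∑ w_n q⁻ⁿ H_n(t₁, t₃) H_n(t₂, t₄)`, which the formula sums again. The formula itself follows from a
functional equation between `a` and `aq`, obtained by telescoping (`sum_mehlerTerm_shift`), by
letting `a` and then `b` tend to `0`; the growth bound `exists_hermiteForm_le` gives all convergence.

The product `φ_n(x; t₁, t₂, t₃, t₄) χ_{t₁}(x)` is a linear combination of the functions
`χ_{t₁q^k}(x)`, `k ≤ n` (`phi4_mul_chi`); this provides the continuous extension over the poles.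
Therefore the biorthogonality integral is a double sum of integrals of the above kind, whose
parameters satisfy the same bounds. For `n ≤ m` and a fixed summation index `j ≤ n` of `φ_n`, the sum
over the index of `φ_m` is a `q`-Saalschütz sum. For `j < m` it vanishes, because the coefficients
`(q⁻ᵐ; q)_k q^k / (q; q)_k` annihilate polynomials in `q^k` of degree below `m`. Only `j = m = n`
remains, where the sum is evaluated by `sum_termCoeff_mul_qPoch_mul`. These sums are kept in a form
without denominators that depend on `t₁t₂`, so that no parameter values have to be excluded.
-/

noncomputable section

namespace QInvHermite

open Filter Topology

/-! ### `q`-shifted factorials -/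

section Pochhammer

variable {R : Type*} [CommRing R]

@[simp] theorem qPoch_zero (a q : R) : qPoch a q 0 = 1 := by simp [qPoch]

theorem qPoch_succ (a q : R) (n : ℕ) : qPoch a q (n + 1) = qPoch a q n * (1 - a * q ^ n) :=
  Finset.prod_range_succ _ _

theorem qPoch_add (a q : R) (m n : ℕ) :
    qPoch a q (m + n) = qPoch a q m * qPoch (a * q ^ m) q n := by
  simp only [qPoch, Finset.prod_range_add, pow_add, mul_assoc]

theorem qPoch_succ' (a q : R) (n : ℕ) :
    qPoch a q (n + 1) = (1 - a) * qPoch (a * q) q n := by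
  rw [add_comm, qPoch_add]; simp [qPoch]

@[simp] theorem qPoch_zero_left (q : R) (n : ℕ) : qPoch 0 q n = 1 := by simp [qPoch]

theorem qPoch_eq_zero_of_mul_pow_eq_one {a q : R} {n k : ℕ} (hk : k < n) (h : a * q ^ k = 1) :
    qPoch a q n = 0 :=
  Finset.prod_eq_zero (Finset.mem_range.2 hk) (by rw [h, sub_self])

end Pochhammer

theorem qPoch_ne_zero {a q : ℂ} (ha : ‖a‖ < 1) (hq : ‖q‖ ≤ 1) (n : ℕ) : qPoch a q n ≠ 0 := by
  refine Finset.prod_ne_zero_iff.2 fun k _ h => ?_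
  have h1 : a * q ^ k = 1 := (sub_eq_zero.1 h).symm
  have h2 : ‖a * q ^ k‖ < 1 := by
    rw [norm_mul, norm_pow]
    exact (mul_le_of_le_one_right (norm_nonneg _) (pow_le_one₀ (norm_nonneg _) hq)).trans_lt ha
  rw [h1, norm_one] at h2
  exact lt_irrefl _ h2

theorem qPochInf_eq_qPoch_mul (a : ℂ) {q : ℂ} (hq : ‖q‖ < 1) (n : ℕ) :
    qPochInf a q = qPoch a q n * qPochInf (a * q ^ n) q := by
  have h := (multipliable_qPochInf (a * q ^ n) q hq)
  have e : (fun k : ℕ => 1 - a * q ^ n * q ^ k) = fun k : ℕ => 1 - a * q ^ (k + n) := by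
    funext k; ring
  rw [e] at h
  unfold qPochInf qPoch
  rw [e, Multipliable.prod_mul_tprod_nat_mul' (f := fun k => 1 - a * q ^ k) h]

theorem qPochInf_succ (a : ℂ) {q : ℂ} (hq : ‖q‖ < 1) :
    qPochInf a q = (1 - a) * qPochInf (a * q) q := by
  simpa [qPoch] using qPochInf_eq_qPoch_mul a hq 1

@[simp] theorem qPochInf_zero (q : ℂ) : qPochInf 0 q = 1 := by simp [qPochInf]

theorem tendsto_qPoch (a : ℂ) {q : ℂ} (hq : ‖q‖ < 1) :
    Tendsto (fun n => qPoch a q n) atTop (𝓝 (qPochInf a q)) :=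
  (multipliable_qPochInf a q hq).hasProd.tendsto_prod_nat

theorem qPochInf_ne_zero {a q : ℂ} (ha : ‖a‖ < 1) (hq : ‖q‖ < 1) : qPochInf a q ≠ 0 := by
  have h := tprod_one_add_ne_zero_of_summable (f := fun k : ℕ => -(a * q ^ k)) (fun k h => ?_) ?_
  · simpa [qPochInf, sub_eq_add_neg] using h
  · have := qPoch_ne_zero ha hq.le (k + 1)
    rw [qPoch_succ, sub_eq_add_neg, h, mul_zero] at this
    exact this rfl
  · simpa [norm_mul, norm_pow] using
      (summable_geometric_of_lt_one (norm_nonneg q) hq).mul_left ‖a‖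

theorem continuous_qPochInf {q : ℂ} (hq : ‖q‖ < 1) : Continuous fun a => qPochInf a q := by
  rw [continuous_iff_continuousAt]
  intro a
  have hs : Summable fun k : ℕ => (‖a‖ + 1) * ‖q‖ ^ k :=
    (summable_geometric_of_lt_one (norm_nonneg q) hq).mul_left _
  have h := Summable.hasProdLocallyUniformlyOn_nat_one_add (K := Metric.ball (0 : ℂ) (‖a‖ + 1))
    (f := fun k z => -(z * q ^ k)) Metric.isOpen_ball hs
    (.of_forall fun k z hz => by
      rw [mem_ball_zero_iff] at hz
      rw [norm_neg, norm_mul, norm_pow]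
      gcongr)
    (fun k => by fun_prop)
  have hc := h.continuousOn (.of_forall fun s => by fun_prop)
  have := hc.continuousAt (Metric.isOpen_ball.mem_nhds (x := a) (by simp))
  simpa [qPochInf, sub_eq_add_neg] using this

/-! ### The homogeneous form of the `q⁻¹`-Hermite polynomials -/

section Field

variable {K : Type*} [Field K]

/-- The homogeneous polynomial
`H_n(a, b) = ∑_k q^{k(k-1)/2 + (n-k)(n-k-1)/2} a^k b^{n-k} / ((q; q)_k (q; q)_{n-k})`,
that is, the coefficient of `z^n` in `(-az, -bz; q)_∞`. It is defined by the recurrence that results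
from comparing the coefficients of this product at `z` and at `qz`. -/
def hermiteForm (q a b : K) : ℕ → K
  | 0 => 1
  | 1 => (a + b) / (1 - q)
  | n + 2 => ((a + b) * q ^ (n + 1) * hermiteForm q a b (n + 1)
      + a * b * q ^ n * hermiteForm q a b n) / (1 - q ^ (n + 2))

/-- The weight `w_n = q^{-n(n-1)/2} (q; q)_n`, as a product of `n` factors. -/
def hermiteWeight (q : K) (n : ℕ) : K := ∏ k ∈ Finset.range n, (1 - q ^ (k + 1)) / q ^ k

@[simp] theorem hermiteForm_zero (q a b : K) : hermiteForm q a b 0 = 1 := by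
  rw [hermiteForm]

theorem hermiteForm_one (q a b : K) : hermiteForm q a b 1 = (a + b) / (1 - q) := by
  rw [hermiteForm]

theorem hermiteForm_add_two (q a b : K) (n : ℕ) :
    hermiteForm q a b (n + 2) = ((a + b) * q ^ (n + 1) * hermiteForm q a b (n + 1)
      + a * b * q ^ n * hermiteForm q a b n) / (1 - q ^ (n + 2)) := by
  rw [hermiteForm]

@[simp] theorem hermiteWeight_zero (q : K) : hermiteWeight q 0 = 1 := by simp [hermiteWeight]

theorem hermiteWeight_succ (q : K) (n : ℕ) :
    hermiteWeight q (n + 1) = hermiteWeight q n * ((1 - q ^ (n + 1)) / q ^ n) :=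
  Finset.prod_range_succ _ _

theorem hermiteForm_comm (q a b : K) (n : ℕ) : hermiteForm q a b n = hermiteForm q b a n := by
  induction n using Nat.twoStepInduction with
  | zero => simp
  | one => rw [hermiteForm_one, hermiteForm_one, add_comm]
  | more n h0 h1 => rw [hermiteForm_add_two, hermiteForm_add_two, h0, h1, add_comm a, mul_comm a]

/-- `H_n` is homogeneous of degree `n`. -/
theorem hermiteForm_mul_mul (q a b s : K) (n : ℕ) :
    hermiteForm q (s * a) (s * b) n = s ^ n * hermiteForm q a b n := by
  induction n using Nat.twoStepInduction with
  | zero => simp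
  | one => rw [hermiteForm_one, hermiteForm_one]; ring
  | more n h0 h1 => rw [hermiteForm_add_two, hermiteForm_add_two, h0, h1]; ring

theorem hermiteForm_zero_zero_succ (q : K) (n : ℕ) : hermiteForm q 0 0 (n + 1) = 0 := by
  simpa using hermiteForm_mul_mul q 0 0 0 (n + 1)

variable {q : K}

theorem hermiteForm_recurrence (hq : ∀ n : ℕ, 1 - q ^ (n + 1) ≠ 0) (a b : K) (n : ℕ) :
    (1 - q ^ (n + 2)) * hermiteForm q a b (n + 2) =
      (a + b) * q ^ (n + 1) * hermiteForm q a b (n + 1) + a * b * q ^ n * hermiteForm q a b n := by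
  rw [hermiteForm_add_two, mul_div_cancel₀ _ (hq (n + 1))]

/-- Both identities compare coefficients in generating functions: the first one in
`(-az, -bz; q)_∞ = (1 + az) (-aqz, -bz; q)_∞`, the second one in the expression of
`(-aqz, -bz; q)_∞ - (-aq²z, -bqz; q)_∞` through `(-aqz, -bqz; q)_∞` and `(-aq²z, -bqz; q)_∞`. They
are proved together, as each step of the one uses the other. -/
theorem hermiteForm_shift (hq : ∀ n : ℕ, 1 - q ^ (n + 1) ≠ 0) (a b : K) (n : ℕ) :
    hermiteForm q a b (n + 1) = hermiteForm q (a * q) b (n + 1) + a * hermiteForm q (a * q) b n ∧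
    (1 - q ^ (n + 1)) * hermiteForm q (a * q) b (n + 1) =
      q ^ n * (b * hermiteForm q a b n + a * q * hermiteForm q (a * q) b n) := by
  induction n with
  | zero =>
    have h1 : 1 - q ≠ 0 := by simpa using hq 0
    simp only [hermiteForm_one, hermiteForm_zero, zero_add, pow_one, pow_zero]
    constructor <;> field_simp <;> ring
  | succ n ih =>
    obtain ⟨h1, h2⟩ := ih
    have r1 := hermiteForm_recurrence hq (a * q) b n
    have r2 := hermiteForm_recurrence hq a b n
    have h3 : (1 - q ^ (n + 2)) * hermiteForm q (a * q) b (n + 2) =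
      q ^ (n + 1) * (b * hermiteForm q a b (n + 1)
        + a * q * hermiteForm q (a * q) b (n + 1)) := by
      rw [r1, h1]; ring
    refine ⟨mul_left_cancel₀ (hq (n + 1)) ?_, h3⟩
    rw [mul_add, h3, r2]
    linear_combination (a * q ^ (n + 1)) * h1 - a * h2

end Field

/-! ### Growth of the forms -/

theorem hermiteForm_nonneg {q a b : ℝ} (hq0 : 0 ≤ q) (hq1 : q < 1) (ha : 0 ≤ a) (hb : 0 ≤ b)
    (n : ℕ) : 0 ≤ hermiteForm q a b n := by
  induction n using Nat.twoStepInduction with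
  | zero => simp
  | one => rw [hermiteForm_one]; exact div_nonneg (by positivity) (by linarith)
  | more n h0 h1 =>
    rw [hermiteForm_add_two]
    have : q ^ (n + 2) ≤ 1 := pow_le_one₀ hq0 hq1.le
    exact div_nonneg (by positivity) (by linarith)

/-- As the coefficients of `H_n` are nonnegative, its real values dominate the complex ones. -/
theorem norm_hermiteForm_le {q : ℝ} (hq0 : 0 ≤ q) (hq1 : q < 1) {a b : ℂ} {α β : ℝ}
    (ha : ‖a‖ ≤ α) (hb : ‖b‖ ≤ β) (n : ℕ) : ‖hermiteForm (q : ℂ) a b n‖ ≤ hermiteForm q α β n := by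
  have hα : 0 ≤ α := (norm_nonneg a).trans ha
  have hβ : 0 ≤ β := (norm_nonneg b).trans hb
  have hn (n : ℕ) : ‖(1 : ℂ) - (q : ℂ) ^ (n + 1)‖ = 1 - q ^ (n + 1) := by
    have : q ^ (n + 1) ≤ 1 := pow_le_one₀ hq0 hq1.le
    rw [← Complex.ofReal_pow, ← Complex.ofReal_one, ← Complex.ofReal_sub, Complex.norm_real,
      Real.norm_of_nonneg (by linarith)]
  have hpos (n : ℕ) : 0 < 1 - q ^ (n + 1) := by
    have := pow_lt_one₀ hq0 hq1 n.succ_ne_zero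
    simpa using this
  have hqn : ‖(q : ℂ)‖ = q := by rw [Complex.norm_real, Real.norm_of_nonneg hq0]
  have hab : ‖a + b‖ ≤ α + β := (norm_add_le _ _).trans (add_le_add ha hb)
  induction n using Nat.twoStepInduction with
  | zero => simp
  | one =>
    have := hn 0
    have h2 := hpos 0
    simp only [zero_add, pow_one] at this h2
    rw [hermiteForm_one, hermiteForm_one, norm_div, this]
    gcongr
  | more n h0 h1 =>
    rw [hermiteForm_add_two, hermiteForm_add_two, norm_div, hn (n + 1)]
    have := hpos (n + 1)
    have h3 := hermiteForm_nonneg hq0 hq1 hα hβ n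
    have h4 := hermiteForm_nonneg hq0 hq1 hα hβ (n + 1)
    gcongr
    refine (norm_add_le _ _).trans ?_
    simp only [norm_mul, norm_pow, hqn]
    gcongr

/-- With `q = r⁴`, `H_n(a, b)` grows at most like `ρ^n r^{n²}` for every `ρ > √(ab/q)`: in the
recurrence the term with `H_n` dominates, as the one with `H_{n+1}` carries an additional
factor `r^{2n}`. -/
theorem exists_hermiteForm_le {r a b ρ : ℝ} (hr0 : 0 < r) (hr1 : r < 1) (ha : 0 ≤ a) (hb : 0 ≤ b)
    (hρ : 0 < ρ) (h : a * b < ρ ^ 2 * r ^ 4) :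
    ∃ C, 0 < C ∧ ∀ n, hermiteForm (r ^ 4) a b n ≤ C * (ρ ^ n * r ^ (n ^ 2)) := by
  have hq0 : 0 ≤ r ^ 4 := by positivity
  have hq1 : r ^ 4 < 1 := pow_lt_one₀ hr0.le hr1 (by norm_num)
  have hev : ∀ᶠ n : ℕ in atTop,
      (a + b) * r ^ 5 * ρ * (r ^ n) ^ 2 + a * b < (1 - r ^ 8 * (r ^ n) ^ 4) * ρ ^ 2 * r ^ 4 := by
    have hr := tendsto_pow_atTop_nhds_zero_of_lt_one hr0.le hr1
    have h1 : Tendsto (fun n : ℕ => (a + b) * r ^ 5 * ρ * (r ^ n) ^ 2 + a * b) atTop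
        (𝓝 ((a + b) * r ^ 5 * ρ * 0 ^ 2 + a * b)) := ((hr.pow 2).const_mul _).add_const _
    have h2 : Tendsto (fun n : ℕ => (1 - r ^ 8 * (r ^ n) ^ 4) * ρ ^ 2 * r ^ 4) atTop
        (𝓝 ((1 - r ^ 8 * 0 ^ 4) * ρ ^ 2 * r ^ 4)) :=
      ((((hr.pow 4).const_mul _).const_sub _).mul_const _).mul_const _
    exact h1.eventually_lt h2 (by simpa using h)
  obtain ⟨N, hN⟩ := eventually_atTop.1 hev
  set u : ℕ → ℝ := fun n => hermiteForm (r ^ 4) a b n / (ρ ^ n * r ^ (n ^ 2)) with hu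
  have hden (n : ℕ) : 0 < ρ ^ n * r ^ (n ^ 2) := by positivity
  have hun (n : ℕ) : 0 ≤ u n := div_nonneg (hermiteForm_nonneg hq0 hq1 ha hb n) (hden n).le
  set C := 1 + ∑ k ∈ Finset.range (N + 2), u k with hC
  have hsum : 0 ≤ ∑ k ∈ Finset.range (N + 2), u k := Finset.sum_nonneg fun k _ => hun k
  have hC0 : 0 < C := by positivity
  refine ⟨C, hC0, fun n => ?_⟩
  induction n using Nat.strong_induction_on with
  | _ n ih =>
  by_cases hn : n < N + 2
  · rw [← div_le_iff₀ (hden n)]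
    -- `C` was chosen to exceed the quotients of the first `N + 2` indices.
    have := Finset.single_le_sum (f := u) (fun k _ => hun k) (Finset.mem_range.2 hn)
    change u n ≤ C
    linarith
  · obtain ⟨m, rfl⟩ : ∃ m, n = m + 2 := ⟨n - 2, by omega⟩
    have h0 := ih m (by omega)
    have h1 := ih (m + 1) (by omega)
    have hm := (hN m (by omega)).le
    have hpos : 0 < 1 - (r ^ 4) ^ (m + 2) := by
      have := pow_lt_one₀ hq0 hq1 (m + 1).succ_ne_zero
      simpa using this
    rw [hermiteForm_add_two, div_le_iff₀ hpos]
    calc _ ≤ (a + b) * (r ^ 4) ^ (m + 1) * (C * (ρ ^ (m + 1) * r ^ ((m + 1) ^ 2)))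
          + a * b * (r ^ 4) ^ m * (C * (ρ ^ m * r ^ (m ^ 2))) := by gcongr
      _ = C * ρ ^ m * r ^ (m ^ 2) * (r ^ 4) ^ m
          * ((a + b) * r ^ 5 * ρ * (r ^ m) ^ 2 + a * b) := by ring
      _ ≤ C * ρ ^ m * r ^ (m ^ 2) * (r ^ 4) ^ m
          * ((1 - r ^ 8 * (r ^ m) ^ 4) * ρ ^ 2 * r ^ 4) := by gcongr
      _ = _ := by ring

theorem hermiteWeight_nonneg {q : ℝ} (hq0 : 0 ≤ q) (hq1 : q ≤ 1) (n : ℕ) : 0 ≤ hermiteWeight q n :=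
  Finset.prod_nonneg fun k _ =>
    div_nonneg (sub_nonneg.2 (pow_le_one₀ hq0 hq1)) (by positivity)

theorem hermiteWeight_mul_pow_le {r : ℝ} (hr0 : 0 < r) (hr1 : r < 1) (n : ℕ) :
    hermiteWeight (r ^ 4) n * r ^ (2 * n ^ 2) ≤ r ^ (2 * n) := by
  induction n with
  | zero => simp
  | succ n ih =>
    have hq1 : r ^ 4 ≤ 1 := pow_le_one₀ hr0.le hr1.le
    have h1 : 1 - (r ^ 4) ^ (n + 1) ≤ 1 := by
      have : 0 < (r ^ 4) ^ (n + 1) := by positivity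
      linarith
    have h2 : 0 ≤ 1 - (r ^ 4) ^ (n + 1) := sub_nonneg.2 (pow_le_one₀ (by positivity) hq1)
    calc _ = (hermiteWeight (r ^ 4) n * r ^ (2 * n ^ 2)) * ((1 - (r ^ 4) ^ (n + 1)) * r ^ 2) := by
          rw [hermiteWeight_succ]; field_simp; ring
      _ ≤ r ^ (2 * n) * (1 * r ^ 2) := by
          refine mul_le_mul ih ?_ (by positivity) (by positivity)
          gcongr
      _ = _ := by ring

theorem ofReal_hermiteWeight (q : ℝ) (n : ℕ) :
    ((hermiteWeight q n : ℝ) : ℂ) = hermiteWeight (q : ℂ) n := by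
  simp [hermiteWeight]

/-- If `xy < z` then `x` and `y` can be enlarged to positive squares without losing this. -/
theorem exists_sq_gt_mul_lt {x y z : ℝ} (hx : 0 ≤ x) (hy : 0 ≤ y) (h : x * y < z) :
    ∃ ρ σ : ℝ, 0 < ρ ∧ 0 < σ ∧ x < ρ ^ 2 ∧ y < σ ^ 2 ∧ (ρ * σ) ^ 2 < z := by
  have hc : Continuous fun ε : ℝ => (x + ε) * (y + ε) := by fun_prop
  have h1 : ∀ᶠ ε in 𝓝 (0 : ℝ), (x + ε) * (y + ε) < z :=
    hc.continuousAt.eventually_lt continuousAt_const (by simpa using h)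
  obtain ⟨ε, hε, hε0⟩ := ((h1.filter_mono nhdsWithin_le_nhds).and
    (self_mem_nhdsWithin : Set.Ioi (0 : ℝ) ∈ 𝓝[>] 0)).exists
  have hε0 : 0 < ε := hε0
  refine ⟨√(x + ε), √(y + ε), by positivity, by positivity, ?_, ?_, ?_⟩
  · rw [Real.sq_sqrt (by positivity)]; linarith
  · rw [Real.sq_sqrt (by positivity)]; linarith
  · rw [mul_pow, Real.sq_sqrt (by positivity), Real.sq_sqrt (by positivity)]; exact hε

/-- The growth bounds are stated for `q = r⁴`, so that `r^{n²}` replaces `q^{n²/4}`. -/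
theorem exists_pow_four_eq {q : ℝ} (hq0 : 0 < q) (hq1 : q < 1) :
    ∃ r : ℝ, 0 < r ∧ r < 1 ∧ r ^ 4 = q := by
  refine ⟨√(√q), by positivity, ?_, ?_⟩
  · rw [Real.sqrt_lt' one_pos, Real.sqrt_lt' (by norm_num)]; simpa
  · rw [show 4 = 2 * 2 from rfl, pow_mul, Real.sq_sqrt (by positivity), Real.sq_sqrt hq0.le]

/-- Geometric decay of the terms of the bilinear generating function. -/
theorem exists_hermiteWeight_mul_le {q a b c d : ℝ} (hq0 : 0 < q) (hq1 : q < 1) (ha : 0 ≤ a)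
    (hb : 0 ≤ b) (hc : 0 ≤ c) (hd : 0 ≤ d) (h : a * b * (c * d) < q) :
    ∃ C θ : ℝ, 0 ≤ θ ∧ θ < 1 ∧
      ∀ n, hermiteWeight q n * hermiteForm q a b n * hermiteForm q c d n ≤ C * θ ^ n := by
  obtain ⟨r, hr0, hr1, rfl⟩ := exists_pow_four_eq hq0 hq1
  obtain ⟨ρ, σ, hρ, hσ, h1, h2, h3⟩ := exists_sq_gt_mul_lt (x := a * b / r ^ 4)
    (y := c * d / r ^ 4) (z := 1 / r ^ 4) (by positivity) (by positivity)
    (by rw [div_mul_div_comm, div_lt_div_iff₀ (by positivity) (by positivity)]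
        nlinarith)
  rw [div_lt_iff₀ hq0] at h1 h2
  rw [lt_div_iff₀ hq0] at h3
  obtain ⟨C, hC, hC'⟩ := exists_hermiteForm_le hr0 hr1 ha hb hρ h1
  obtain ⟨D, hD, hD'⟩ := exists_hermiteForm_le hr0 hr1 hc hd hσ h2
  refine ⟨C * D, ρ * σ * r ^ 2, by positivity, ?_, fun n => ?_⟩
  · rw [← sq_lt_one_iff₀ (by positivity)]
    calc _ = (ρ * σ) ^ 2 * r ^ 4 := by ring
      _ < 1 := h3
  · have hw := hermiteWeight_nonneg hq0.le hq1.le n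
    have h4 := hermiteForm_nonneg hq0.le hq1 ha hb n
    have h5 := hermiteForm_nonneg hq0.le hq1 hc hd n
    calc _ ≤ hermiteWeight (r ^ 4) n * (C * (ρ ^ n * r ^ (n ^ 2)))
          * (D * (σ ^ n * r ^ (n ^ 2))) := by
          gcongr
          exacts [hC' n, hD' n]
      _ = C * D * (ρ * σ) ^ n * (hermiteWeight (r ^ 4) n * r ^ (2 * n ^ 2)) := by ring
      _ ≤ C * D * (ρ * σ) ^ n * r ^ (2 * n) := by
          gcongr
          exact hermiteWeight_mul_pow_le hr0 hr1 n
      _ = _ := by ring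

/-- Products with indices that differ by one, as they occur in the boundary terms of the telescoping
sum; they need the stronger bound `q²` on `abcd`. -/
theorem exists_hermiteWeight_mul_succ_le {q a b c d : ℝ} (hq0 : 0 < q) (hq1 : q < 1) (ha : 0 ≤ a)
    (hb : 0 ≤ b) (hc : 0 ≤ c) (hd : 0 ≤ d) (h : a * b * (c * d) < q ^ 2) :
    ∃ C θ : ℝ, 0 ≤ θ ∧ θ < 1 ∧
      ∀ n, hermiteWeight q (n + 1) * hermiteForm q a b (n + 1) * hermiteForm q c d n
        ≤ C * θ ^ n := by
  obtain ⟨r, hr0, hr1, rfl⟩ := exists_pow_four_eq hq0 hq1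
  obtain ⟨ρ, σ, hρ, hσ, h1, h2, h3⟩ := exists_sq_gt_mul_lt (x := a * b / r ^ 4)
    (y := c * d / r ^ 4) (z := 1) (by positivity) (by positivity)
    (by rw [div_mul_div_comm, div_lt_one (by positivity)]
        nlinarith)
  rw [div_lt_iff₀ hq0] at h1 h2
  obtain ⟨C, hC, hC'⟩ := exists_hermiteForm_le hr0 hr1 ha hb hρ h1
  obtain ⟨D, hD, hD'⟩ := exists_hermiteForm_le hr0 hr1 hc hd hσ h2
  refine ⟨C * D * ρ, ρ * σ, by positivity, ?_, fun n => ?_⟩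
  · rwa [← sq_lt_one_iff₀ (by positivity)]
  · have hw := hermiteWeight_nonneg hq0.le hq1.le (n + 1)
    have h4 := hermiteForm_nonneg hq0.le hq1 ha hb (n + 1)
    have h5 := hermiteForm_nonneg hq0.le hq1 hc hd n
    have h6 : hermiteWeight (r ^ 4) (n + 1) * r ^ (2 * n ^ 2 + 2 * n + 1) ≤ 1 := by
      have h7 : hermiteWeight (r ^ 4) (n + 1) * r ^ (2 * n ^ 2 + 2 * n + 1) * r ^ (2 * n + 1)
          ≤ r * r ^ (2 * n + 1) := by
        calc _ = hermiteWeight (r ^ 4) (n + 1) * r ^ (2 * (n + 1) ^ 2) := by ring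
          _ ≤ r ^ (2 * (n + 1)) := hermiteWeight_mul_pow_le hr0 hr1 (n + 1)
          _ = _ := by ring
      exact (le_of_mul_le_mul_right h7 (by positivity)).trans hr1.le
    calc _ ≤ hermiteWeight (r ^ 4) (n + 1) * (C * (ρ ^ (n + 1) * r ^ ((n + 1) ^ 2)))
          * (D * (σ ^ n * r ^ (n ^ 2))) := by
          gcongr
          exacts [hC' _, hD' n]
      _ = C * D * ρ * (ρ * σ) ^ n *
          (hermiteWeight (r ^ 4) (n + 1) * r ^ (2 * n ^ 2 + 2 * n + 1)) := by ring
      _ ≤ C * D * ρ * (ρ * σ) ^ n * 1 := by gcongr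
      _ = _ := by ring

/-- As `q⁻ⁿ w_n` is the squared norm of `h_n`, this bounds the norms of the terms
of `∑ H_n(a, b) h_n` in `L²(μ)`. -/
theorem exists_hermiteWeight_mul_sq_le {q a b : ℝ} (hq0 : 0 < q) (hq1 : q < 1) (ha : 0 ≤ a)
    (hb : 0 ≤ b) (h : a * b < q ^ (3 / 2 : ℝ)) :
    ∃ C θ : ℝ, 0 ≤ C ∧ 0 ≤ θ ∧ θ < 1 ∧
      ∀ n, hermiteWeight q n / q ^ n * hermiteForm q a b n ^ 2 ≤ (C * θ ^ n) ^ 2 := by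
  obtain ⟨r, hr0, hr1, rfl⟩ := exists_pow_four_eq hq0 hq1
  have h' : (r ^ 4 : ℝ) ^ (3 / 2 : ℝ) = r ^ 2 * r ^ 4 := by
    rw [← Real.rpow_natCast r 4, ← Real.rpow_natCast r 2, ← Real.rpow_mul hr0.le,
      ← Real.rpow_add hr0]
    norm_num
  rw [h', ← div_lt_iff₀ hq0] at h
  obtain ⟨s, hs1, hs2⟩ := exists_between h
  have hs0 : 0 < s := lt_of_le_of_lt (by positivity) hs1
  have hρ : 0 < √s := by positivity
  obtain ⟨C, hC, hC'⟩ := exists_hermiteForm_le hr0 hr1 ha hb hρ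
    (by rwa [Real.sq_sqrt hs0.le, ← div_lt_iff₀ hq0])
  refine ⟨C, √s / r, hC.le, by positivity, ?_, fun n => ?_⟩
  · rwa [div_lt_one hr0, Real.sqrt_lt' hr0]
  · have hw := hermiteWeight_nonneg hq0.le hq1.le n
    have h4 := hermiteForm_nonneg hq0.le hq1 ha hb n
    calc _ ≤ hermiteWeight (r ^ 4) n / (r ^ 4) ^ n * (C * (√s ^ n * r ^ (n ^ 2))) ^ 2 := by
          gcongr
          exact hC' n
      _ = (C * √s ^ n) ^ 2 / (r ^ 4) ^ n * (hermiteWeight (r ^ 4) n * r ^ (2 * n ^ 2)) := by ring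
      _ ≤ (C * √s ^ n) ^ 2 / (r ^ 4) ^ n * r ^ (2 * n) := by
          gcongr
          exact hermiteWeight_mul_pow_le hr0 hr1 n
      _ = _ := by
          rw [show (r ^ 4) ^ n = (r ^ n) ^ 2 * r ^ (2 * n) by ring, div_pow]
          field_simp

/-! ### The bilinear generating function -/

/-- The terms `w_n H_n(a, b) H_n(c, d)` of the bilinear generating function. -/
def mehlerTerm (q : ℝ) (a b c d : ℂ) (n : ℕ) : ℂ :=
  hermiteWeight (q : ℂ) n * hermiteForm (q : ℂ) a b n * hermiteForm (q : ℂ) c d n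

theorem norm_hermiteWeight {q : ℝ} (hq0 : 0 < q) (hq1 : q < 1) (n : ℕ) :
    ‖hermiteWeight (q : ℂ) n‖ = hermiteWeight q n := by
  rw [← ofReal_hermiteWeight, Complex.norm_real,
    Real.norm_of_nonneg (hermiteWeight_nonneg hq0.le hq1.le n)]

theorem one_sub_ofReal_pow_ne_zero {q : ℝ} (hq0 : 0 < q) (hq1 : q < 1) (n : ℕ) :
    (1 : ℂ) - (q : ℂ) ^ (n + 1) ≠ 0 := by
  rw [← Complex.ofReal_pow, ← Complex.ofReal_one, ← Complex.ofReal_sub, Complex.ofReal_ne_zero]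
  have := pow_lt_one₀ hq0.le hq1 n.succ_ne_zero
  exact (sub_pos.2 this).ne'

theorem norm_ofReal_lt_one {q : ℝ} (hq0 : 0 < q) (hq1 : q < 1) : ‖(q : ℂ)‖ < 1 := by
  rwa [Complex.norm_real, Real.norm_of_nonneg hq0.le]

theorem norm_mehlerTerm_le {q : ℝ} (hq0 : 0 < q) (hq1 : q < 1) {a b c d : ℂ} {α β γ δ : ℝ}
    (ha : ‖a‖ ≤ α) (hb : ‖b‖ ≤ β) (hc : ‖c‖ ≤ γ) (hd : ‖d‖ ≤ δ) (n : ℕ) :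
    ‖mehlerTerm q a b c d n‖ ≤ hermiteWeight q n * hermiteForm q α β n * hermiteForm q γ δ n := by
  have h1 := norm_hermiteForm_le hq0.le hq1 ha hb n
  have h2 := norm_hermiteForm_le hq0.le hq1 hc hd n
  rw [mehlerTerm, norm_mul, norm_mul, norm_hermiteWeight hq0 hq1]
  have hw := hermiteWeight_nonneg hq0.le hq1.le n
  have h3 := (norm_nonneg _).trans h1
  gcongr

theorem summable_hermiteWeight_mul {q : ℝ} (hq0 : 0 < q) (hq1 : q < 1) {a b c d : ℂ}
    (h : ‖a * b * (c * d)‖ < q) : Summable fun n =>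
      hermiteWeight q n * hermiteForm q ‖a‖ ‖b‖ n * hermiteForm q ‖c‖ ‖d‖ n := by
  obtain ⟨C, θ, h0, h1, hC⟩ := exists_hermiteWeight_mul_le hq0 hq1 (norm_nonneg a) (norm_nonneg b)
    (norm_nonneg c) (norm_nonneg d) (by simpa [norm_mul] using h)
  refine .of_nonneg_of_le (fun n => ?_) hC ((summable_geometric_of_lt_one h0 h1).mul_left C)
  exact (norm_nonneg _).trans (norm_mehlerTerm_le hq0 hq1 le_rfl le_rfl le_rfl le_rfl n)

theorem summable_norm_mehlerTerm {q : ℝ} (hq0 : 0 < q) (hq1 : q < 1) {a b c d : ℂ}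
    (h : ‖a * b * (c * d)‖ < q) : Summable fun n => ‖mehlerTerm q a b c d n‖ :=
  .of_nonneg_of_le (fun _ => norm_nonneg _)
    (fun n => norm_mehlerTerm_le hq0 hq1 le_rfl le_rfl le_rfl le_rfl n)
    (summable_hermiteWeight_mul hq0 hq1 h)

theorem tendsto_hermiteWeight_mul_succ {q : ℝ} (hq0 : 0 < q) (hq1 : q < 1) {a b c d : ℂ}
    (h : ‖a * b * (c * d)‖ < q ^ 2) : Tendsto (fun n => hermiteWeight (q : ℂ) (n + 1) *
      hermiteForm (q : ℂ) a b (n + 1) * hermiteForm (q : ℂ) c d n) atTop (𝓝 0) := by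
  obtain ⟨C, θ, h0, h1, hC⟩ := exists_hermiteWeight_mul_succ_le hq0 hq1 (norm_nonneg a)
    (norm_nonneg b) (norm_nonneg c) (norm_nonneg d) (by simpa [norm_mul] using h)
  refine squeeze_zero_norm (fun n => (?_ : _ ≤ C * θ ^ n)) ?_
  · refine le_trans ?_ (hC n)
    have h1 := norm_hermiteForm_le hq0.le hq1 (le_refl ‖a‖) (le_refl ‖b‖) (n + 1)
    have h2 := norm_hermiteForm_le hq0.le hq1 (le_refl ‖c‖) (le_refl ‖d‖) n
    rw [norm_mul, norm_mul, norm_hermiteWeight hq0 hq1]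
    have hw := hermiteWeight_nonneg hq0.le hq1.le (n + 1)
    have h3 := (norm_nonneg _).trans h1
    gcongr
  · simpa using (tendsto_pow_atTop_nhds_zero_of_lt_one h0 h1).const_mul C

/-- The functional equation of the bilinear generating function, for the partial sums: by the
recurrence of `H_n(c, d)` and the shift relations of `H_n(a, b)` the difference of the two sides
telescopes. -/
theorem sum_mehlerTerm_shift {q : ℝ} (hq0 : 0 < q) (hq1 : q < 1) (a b c d : ℂ) (N : ℕ) :
    ∑ n ∈ Finset.range (N + 1), ((1 - a * b * (c * d) / q) * mehlerTerm q a b c d n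
      - (1 + a * c) * (1 + a * d) * mehlerTerm q (a * q) b c d n) =
    -a * (hermiteWeight (q : ℂ) (N + 1) * hermiteForm (q : ℂ) c d (N + 1)
        * hermiteForm (q : ℂ) (a * q) b N
      + c * d / q * (hermiteWeight (q : ℂ) (N + 1) * hermiteForm (q : ℂ) (a * q) b (N + 1)
        * hermiteForm (q : ℂ) c d N)) := by
  have hq : (q : ℂ) ≠ 0 := by exact_mod_cast hq0.ne'
  have hn := one_sub_ofReal_pow_ne_zero hq0 hq1
  induction N with
  | zero =>
    have h1 := hn 0
    simp only [zero_add, pow_one] at h1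
    simp only [zero_add, Finset.sum_range_one, mehlerTerm, hermiteForm_zero, hermiteForm_one,
      hermiteWeight_succ, hermiteWeight_zero, pow_zero, pow_one]
    field_simp
    ring
  | succ N ih =>
    rw [Finset.sum_range_succ, ih]
    have s1 := (hermiteForm_shift hn a b N).1
    have s2 := (hermiteForm_shift hn a b (N + 1)).2
    have r := hermiteForm_recurrence hn c d N
    have hqN : (q : ℂ) ^ N ≠ 0 := pow_ne_zero _ hq
    have e1 : hermiteWeight (q : ℂ) (N + 2) * hermiteForm (q : ℂ) c d (N + 2) =
        hermiteWeight (q : ℂ) (N + 1) * ((c + d) * hermiteForm (q : ℂ) c d (N + 1)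
          + c * d / q * hermiteForm (q : ℂ) c d N) := by
      rw [hermiteWeight_succ _ (N + 1), mul_assoc, div_mul_eq_mul_div, r]
      field_simp
      ring
    have e2 : hermiteWeight (q : ℂ) (N + 2) * hermiteForm (q : ℂ) (a * q) b (N + 2) =
        hermiteWeight (q : ℂ) (N + 1) * (b * hermiteForm (q : ℂ) a b (N + 1)
          + a * q * hermiteForm (q : ℂ) (a * q) b (N + 1)) := by
      rw [hermiteWeight_succ _ (N + 1), mul_assoc, div_mul_eq_mul_div, s2]
      field_simp
    rw [show N + 1 + 1 = N + 2 from rfl, e1, e2]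
    simp only [mehlerTerm]
    rw [s1]
    field_simp
    ring

/-- The sum of the bilinear generating function. -/
def mehlerSum (q : ℝ) (a b c d : ℂ) : ℂ := ∑' n, mehlerTerm q a b c d n

theorem mehlerSum_comm (q : ℝ) (a b c d : ℂ) : mehlerSum q a b c d = mehlerSum q b a c d := by
  simp only [mehlerSum, mehlerTerm, hermiteForm_comm (q : ℂ) a b]

theorem norm_mul_ofReal_pow_le {q : ℝ} (hq0 : 0 < q) (hq1 : q < 1) (a : ℂ) (N : ℕ) :
    ‖a * (q : ℂ) ^ N‖ ≤ ‖a‖ := by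
  rw [norm_mul, norm_pow]
  exact mul_le_of_le_one_right (norm_nonneg _)
    (pow_le_one₀ (norm_nonneg _) (norm_ofReal_lt_one hq0 hq1).le)

theorem mehlerSum_shift {q : ℝ} (hq0 : 0 < q) (hq1 : q < 1) {a b c d : ℂ}
    (h : ‖a * b * (c * d)‖ < q) :
    (1 - a * b * (c * d) / q) * mehlerSum q a b c d =
      (1 + a * c) * (1 + a * d) * mehlerSum q (a * q) b c d := by
  have hqn : ‖(q : ℂ)‖ = q := by rw [Complex.norm_real, Real.norm_of_nonneg hq0.le]
  -- The boundary terms contain `aq` in place of `a`, which provides the additional factor `q`.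
  have h2 : ‖a * q * b * (c * d)‖ < q ^ 2 := by
    rw [show a * q * b * (c * d) = a * b * (c * d) * q by ring, norm_mul, hqn, sq]
    gcongr
  have h1 : ‖a * q * b * (c * d)‖ < q := h2.trans_le (by nlinarith)
  have s1 := ((summable_norm_mehlerTerm hq0 hq1 h).of_norm.hasSum).mul_left (1 - a * b * (c * d) / q)
  have s2 := ((summable_norm_mehlerTerm hq0 hq1 h1).of_norm.hasSum).mul_left
    ((1 + a * c) * (1 + a * d))
  have t1 := (tendsto_add_atTop_iff_nat 1).2 (s1.sub s2).tendsto_sum_nat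
  have t2 := tendsto_hermiteWeight_mul_succ hq0 hq1 h2
  have t3 := tendsto_hermiteWeight_mul_succ hq0 hq1 (a := c) (b := d) (c := a * q) (d := b)
    (by rwa [mul_comm])
  have t4 := (t3.add (t2.const_mul (c * d / q))).const_mul (-a)
  simp only [sum_mehlerTerm_shift hq0 hq1] at t1
  have := tendsto_nhds_unique t1 t4
  rw [mul_zero, add_zero, mul_zero] at this
  exact sub_eq_zero.1 this

theorem mehlerSum_shift_pow {q : ℝ} (hq0 : 0 < q) (hq1 : q < 1) {a b c d : ℂ}
    (h : ‖a * b * (c * d)‖ < q) (N : ℕ) :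
    qPoch (a * b * (c * d) / q) (q : ℂ) N * mehlerSum q a b c d =
      qPoch (-a * c) (q : ℂ) N * qPoch (-a * d) (q : ℂ) N * mehlerSum q (a * (q : ℂ) ^ N) b c d := by
  induction N with
  | zero => simp
  | succ N ih =>
    have h1 : ‖a * (q : ℂ) ^ N * b * (c * d)‖ < q := by
      rw [show a * (q : ℂ) ^ N * b * (c * d) = a * b * (c * d) * (q : ℂ) ^ N by ring]
      exact (norm_mul_ofReal_pow_le hq0 hq1 _ N).trans_lt h
    have h2 := mehlerSum_shift hq0 hq1 h1
    rw [mul_assoc a _ (q : ℂ), ← pow_succ] at h2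
    simp only [qPoch_succ]
    linear_combination (1 - a * b * (c * d) / q * (q : ℂ) ^ N) * ih
      + qPoch (-a * c) (q : ℂ) N * qPoch (-a * d) (q : ℂ) N * h2

theorem continuous_hermiteForm_left (q b : ℂ) (n : ℕ) :
    Continuous fun a => hermiteForm q a b n := by
  induction n using Nat.twoStepInduction with
  | zero => simpa using continuous_const
  | one => simp only [hermiteForm_one]; fun_prop
  | more n h0 h1 => simp only [hermiteForm_add_two]; fun_prop

/-- The functional equation, iterated: `a q^N` tends to `0`. -/
theorem qPochInf_mul_mehlerSum {q : ℝ} (hq0 : 0 < q) (hq1 : q < 1) {a b c d : ℂ}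
    (h : ‖a * b * (c * d)‖ < q) :
    qPochInf (a * b * (c * d) / q) q * mehlerSum q a b c d =
      qPochInf (-a * c) q * qPochInf (-a * d) q * mehlerSum q 0 b c d := by
  have hq := norm_ofReal_lt_one hq0 hq1
  have h0 : Tendsto (fun N : ℕ => a * (q : ℂ) ^ N) atTop (𝓝 0) := by
    simpa using (tendsto_pow_atTop_nhds_zero_of_norm_lt_one hq).const_mul a
  have t : Tendsto (fun N : ℕ => mehlerSum q (a * (q : ℂ) ^ N) b c d) atTop
      (𝓝 (mehlerSum q 0 b c d)) := by
    refine tendsto_tsum_of_dominated_convergence (summable_hermiteWeight_mul hq0 hq1 h)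
      (fun n => ?_) (.of_forall fun N n => norm_mehlerTerm_le hq0 hq1
        (norm_mul_ofReal_pow_le hq0 hq1 a N) le_rfl le_rfl le_rfl n)
    exact ((((continuous_hermiteForm_left (q : ℂ) b n).tendsto 0).comp h0).const_mul _).mul_const _
  refine tendsto_nhds_unique ((tendsto_qPoch _ hq).mul_const (mehlerSum q a b c d)) ?_
  simp only [mehlerSum_shift_pow hq0 hq1 h]
  exact ((tendsto_qPoch _ hq).mul (tendsto_qPoch _ hq)).mul t

/-- The `q⁻¹`-analogue of Mehler's formula: for `|abcd| < q`,
`∑ w_n H_n(a, b) H_n(c, d) = (-ac, -ad, -bc, -bd; q)_∞ / (abcd/q; q)_∞`. The functional equation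
moves first `a` and then `b` to `0`. -/
theorem mehler_formula {q : ℝ} (hq0 : 0 < q) (hq1 : q < 1) {a b c d : ℂ}
    (h : ‖a * b * (c * d)‖ < q) :
    qPochInf (a * b * (c * d) / q) q * mehlerSum q a b c d =
      qPochInf (-a * c) q * qPochInf (-a * d) q * (qPochInf (-b * c) q * qPochInf (-b * d) q) := by
  have h1 := qPochInf_mul_mehlerSum hq0 hq1 (a := b) (b := 0) (c := c) (d := d) (by simpa)
  have h2 : mehlerSum q 0 0 c d = 1 := by
    rw [mehlerSum, tsum_eq_single 0]
    · simp [mehlerTerm]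
    · intro n hn
      obtain ⟨m, rfl⟩ := Nat.exists_eq_succ_of_ne_zero hn
      simp [mehlerTerm, hermiteForm_zero_zero_succ]
  rw [h2, mehlerSum_comm] at h1
  rw [qPochInf_mul_mehlerSum hq0 hq1 h, ← mul_one (_ * qPochInf (-b * d) _), ← h1]
  simp

/-! ### Expansion of `χ_a χ_b` in `q⁻¹`-Hermite polynomials -/

theorem expXi_mul_expNegXi (x : ℝ) : expXi x * expNegXi x = 1 := by
  rw [expXi, expNegXi, ← Complex.ofReal_mul, ← Real.exp_add]; simp

theorem expXi_sub_expNegXi (x : ℝ) : expXi x - expNegXi x = 2 * x := by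
  have h := Real.sinh_eq (Real.arsinh x)
  rw [Real.sinh_arsinh] at h
  rw [expXi, expNegXi, ← Complex.ofReal_sub]
  have : Real.exp (Real.arsinh x) - Real.exp (-Real.arsinh x) = 2 * x := by linarith
  rw [this]; simp

theorem continuous_expXi : Continuous expXi :=
  Complex.continuous_ofReal.comp (Real.continuous_exp.comp Real.continuous_arsinh)

theorem continuous_expNegXi : Continuous expNegXi :=
  Complex.continuous_ofReal.comp (Real.continuous_exp.comp Real.continuous_arsinh.neg)

theorem continuous_chi {q : ℝ} (hq0 : 0 < q) (hq1 : q < 1) (t : ℂ) : Continuous (chi q t) := by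
  have h := continuous_qPochInf (norm_ofReal_lt_one hq0 hq1)
  exact (h.comp (continuous_expXi.const_mul (-t))).mul
    (h.comp (continuous_expNegXi.const_mul t))

theorem ofReal_qInvHermite {q : ℝ} (hq0 : 0 < q) (hq1 : q < 1) (x : ℝ) (n : ℕ) :
    ((qInvHermite q x n : ℝ) : ℂ) =
      hermiteWeight (q : ℂ) n * hermiteForm (q : ℂ) (expXi x) (-expNegXi x) n := by
  have hq : (q : ℂ) ≠ 0 := by exact_mod_cast hq0.ne'
  have hn := one_sub_ofReal_pow_ne_zero hq0 hq1
  have h1 : expXi x + -expNegXi x = 2 * x := by rw [← sub_eq_add_neg, expXi_sub_expNegXi]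
  have h2 : expXi x * -expNegXi x = -1 := by rw [mul_neg, expXi_mul_expNegXi]
  induction n using Nat.twoStepInduction with
  | zero => simp [qInvHermite]
  | one =>
    have := hn 0
    simp only [zero_add, pow_one] at this
    rw [qInvHermite, hermiteForm_one, h1, hermiteWeight_succ]
    simp only [hermiteWeight_zero, zero_add, pow_one, pow_zero]
    push_cast
    field_simp
  | more n h0 h3 =>
    have r := hermiteForm_recurrence hn (expXi x) (-expNegXi x) n
    rw [h1, h2] at r
    rw [qInvHermite]
    push_cast
    rw [h0, h3, hermiteWeight_succ _ (n + 1), mul_assoc (hermiteWeight _ _), div_mul_eq_mul_div, r,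
      hermiteWeight_succ _ n]
    field_simp
    ring

/-- The bilinear generating function at `c = e^ξ`, `d = -e^{-ξ}`. -/
theorem chi_mul_chi {q : ℝ} (hq0 : 0 < q) (hq1 : q < 1) {a b : ℂ} (h : ‖a * b‖ < q) (x : ℝ) :
    (Summable fun n => ‖hermiteForm (q : ℂ) a b n * (qInvHermite q x n : ℂ)‖) ∧
    chi q a x * chi q b x = qPochInf (-a * b / q) q *
      ∑' n, hermiteForm (q : ℂ) a b n * (qInvHermite q x n : ℂ) := by
  have h1 : ‖a * b * (expXi x * -expNegXi x)‖ < q := by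
    rwa [mul_neg, expXi_mul_expNegXi, mul_neg, mul_one, norm_neg]
  have h2 : mehlerTerm q a b (expXi x) (-expNegXi x) =
      fun n => hermiteForm (q : ℂ) a b n * (qInvHermite q x n : ℂ) := by
    funext n
    rw [ofReal_qInvHermite hq0 hq1, mehlerTerm]; ring
  have h3 := summable_norm_mehlerTerm hq0 hq1 h1
  have h4 := mehler_formula hq0 hq1 h1
  rw [mehlerSum] at h4
  rw [h2] at h3 h4
  refine ⟨h3, ?_⟩
  rw [mul_neg, expXi_mul_expNegXi, mul_neg, mul_one, ← neg_mul, neg_mul_neg, neg_mul_neg] at h4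
  rw [h4]
  rfl

/-! ### The integral of a product of four `χ` -/

theorem exists_polynomial_qInvHermite (q : ℝ) (n : ℕ) :
    ∃ p : Polynomial ℝ, ∀ x, qInvHermite q x n = p.eval x := by
  induction n using Nat.twoStepInduction with
  | zero => exact ⟨1, fun x => by simp [qInvHermite]⟩
  | one => exact ⟨2 * .X, fun x => by simp [qInvHermite]⟩
  | more n h0 h1 =>
    obtain ⟨p, hp⟩ := h0
    obtain ⟨s, hs⟩ := h1
    exact ⟨2 * .X * s - .C ((q ^ (n + 1))⁻¹ * (1 - q ^ (n + 1))) * p,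
      fun x => by simp [qInvHermite, hp, hs]⟩

theorem IsMomentSolution.integrable_mul {q : ℝ} {μ : Measure ℝ} (hμ : IsMomentSolution q μ)
    (m n : ℕ) : Integrable (fun x => qInvHermite q x m * qInvHermite q x n) μ := by
  obtain ⟨p, hp⟩ := exists_polynomial_qInvHermite q m
  obtain ⟨s, hs⟩ := exists_polynomial_qInvHermite q n
  have h (x : ℝ) : qInvHermite q x m * qInvHermite q x n =
      ∑ i ∈ Finset.range ((p * s).natDegree + 1), (p * s).coeff i * x ^ i := by
    rw [hp, hs, ← Polynomial.eval_mul, Polynomial.eval_eq_sum_range]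
  simp only [h]
  exact integrable_finsetSum _ fun i _ => (hμ.integrable_pow i).const_mul _

theorem hermiteWeight_pos {q : ℝ} (hq0 : 0 < q) (hq1 : q < 1) (n : ℕ) : 0 < hermiteWeight q n :=
  Finset.prod_pos fun k _ =>
    div_pos (sub_pos.2 (pow_lt_one₀ hq0.le hq1 k.succ_ne_zero)) (by positivity)

/-- The squared norm of `h_n` is `w_n q⁻ⁿ`. -/
theorem inv_pow_mul_qPoch_eq {q : ℝ} (hq0 : 0 < q) (n : ℕ) :
    (q ^ (n * (n + 1) / 2))⁻¹ * qPoch q q n = hermiteWeight q n / q ^ n := by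
  induction n with
  | zero => simp
  | succ n ih =>
    have h : (n + 1) * (n + 1 + 1) / 2 = n * (n + 1) / 2 + (n + 1) := by
      rw [show (n + 1) * (n + 1 + 1) = n * (n + 1) + (n + 1) * 2 by ring,
        Nat.add_mul_div_right _ _ two_pos]
    rw [h, qPoch_succ, hermiteWeight_succ, pow_add, mul_inv,
      show (q ^ (n * (n + 1) / 2))⁻¹ * (q ^ (n + 1))⁻¹ * (qPoch q q n * (1 - q * q ^ n)) =
        ((q ^ (n * (n + 1) / 2))⁻¹ * qPoch q q n) * ((q ^ (n + 1))⁻¹ * (1 - q * q ^ n)) by ring, ih]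
    field_simp
    ring

theorem IsMomentSolution.integral_mul_eq {q : ℝ} (hq0 : 0 < q) {μ : Measure ℝ}
    (hμ : IsMomentSolution q μ) (m n : ℕ) :
    ∫ x, qInvHermite q x m * qInvHermite q x n ∂μ =
      if m = n then hermiteWeight q n / q ^ n else 0 := by
  rw [hμ.integral_mul, inv_pow_mul_qPoch_eq hq0]

/-- The Cauchy–Schwarz inequality for `h_m` and `h_n`. -/
theorem IsMomentSolution.integral_abs_mul_le {q : ℝ} (hq0 : 0 < q) (hq1 : q < 1) {μ : Measure ℝ}
    (hμ : IsMomentSolution q μ) (m n : ℕ) :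
    ∫ x, |qInvHermite q x m * qInvHermite q x n| ∂μ ≤
      √(hermiteWeight q m / q ^ m) * √(hermiteWeight q n / q ^ n) := by
  have hpos (k : ℕ) : 0 < hermiteWeight q k / q ^ k :=
    div_pos (hermiteWeight_pos hq0 hq1 k) (by positivity)
  set A := √(hermiteWeight q m / q ^ m) with hA
  set B := √(hermiteWeight q n / q ^ n) with hB
  have hA0 : 0 < A := Real.sqrt_pos.2 (hpos m)
  have hB0 : 0 < B := Real.sqrt_pos.2 (hpos n)
  have hm := hμ.integral_mul_eq hq0 m m
  have hn := hμ.integral_mul_eq hq0 n n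
  rw [if_pos rfl, ← Real.sq_sqrt (hpos _).le] at hm hn
  have key : ∫ x, |qInvHermite q x m * qInvHermite q x n| ∂μ ≤
      ∫ x, (B / (2 * A) * (qInvHermite q x m * qInvHermite q x m)
        + A / (2 * B) * (qInvHermite q x n * qInvHermite q x n)) ∂μ := by
    refine integral_mono (hμ.integrable_mul m n).abs
      (((hμ.integrable_mul m m).const_mul _).add ((hμ.integrable_mul n n).const_mul _)) fun x => ?_
    -- The arithmetic-geometric mean inequality, weighted so that both integrals become equal.
    have h := sq_nonneg (B * |qInvHermite q x m| - A * |qInvHermite q x n|)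
    simp only [abs_mul]
    rw [← abs_mul_abs_self (qInvHermite q x m), ← abs_mul_abs_self (qInvHermite q x n)]
    rw [div_mul_eq_mul_div, div_mul_eq_mul_div, div_add_div _ _ (by positivity) (by positivity),
      le_div_iff₀ (by positivity)]
    nlinarith
  refine key.trans_eq ?_
  rw [integral_add ((hμ.integrable_mul m m).const_mul _) ((hμ.integrable_mul n n).const_mul _),
    integral_const_mul, integral_const_mul, hm, hn, ← hA, ← hB]
  field_simp
  ring

theorem integrable_tsum_of_summable_integral_norm {α ι E : Type*} [MeasurableSpace α]
    {μ : Measure α} [NormedAddCommGroup E] [Countable ι] {F : ι → α → E}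
    (hF : ∀ i, Integrable (F i) μ) (hs : Summable fun i => ∫ a, ‖F i a‖ ∂μ)
    (hm : AEStronglyMeasurable (fun a => ∑' i, F i a) μ) :
    Integrable (fun a => ∑' i, F i a) μ := by
  refine ⟨hm, ?_⟩
  rw [hasFiniteIntegral_iff_enorm]
  calc ∫⁻ a, ‖∑' i, F i a‖ₑ ∂μ ≤ ∫⁻ a, ∑' i, ‖F i a‖ₑ ∂μ :=
        lintegral_mono fun a => enorm_tsum_le_tsum_enorm
    _ = ∑' i, ∫⁻ a, ‖F i a‖ₑ ∂μ := lintegral_tsum fun i => (hF i).1.enorm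
    _ = ∑' i, ENNReal.ofReal (∫ a, ‖F i a‖ ∂μ) := by
        simp only [ofReal_integral_norm_eq_lintegral_enorm (hF _)]
    _ = ENNReal.ofReal (∑' i, ∫ a, ‖F i a‖ ∂μ) :=
        (ENNReal.ofReal_tsum_of_nonneg (fun i => integral_nonneg fun a => norm_nonneg _) hs).symm
    _ < ⊤ := ENNReal.ofReal_lt_top

/-- The series `∑ H_n(a, b) h_n` converges absolutely in `L²(μ)`. -/
theorem summable_norm_hermiteForm_mul_sqrt {q : ℝ} (hq0 : 0 < q) (hq1 : q < 1) {a b : ℂ}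
    (h : ‖a * b‖ < q ^ (3 / 2 : ℝ)) :
    Summable fun n => ‖hermiteForm (q : ℂ) a b n‖ * √(hermiteWeight q n / q ^ n) := by
  obtain ⟨C, θ, hC, h0, h1, hb⟩ := exists_hermiteWeight_mul_sq_le hq0 hq1 (norm_nonneg a)
    (norm_nonneg b) (by rwa [← norm_mul])
  refine .of_nonneg_of_le (fun n => by positivity) (fun n => ?_)
    ((summable_geometric_of_lt_one h0 h1).mul_left C)
  refine le_trans ?_ (Real.sqrt_le_sqrt (hb n) |>.trans_eq (Real.sqrt_sq (by positivity)))
  have hw := (hermiteWeight_pos hq0 hq1 n).le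
  rw [Real.sqrt_mul (by positivity), mul_comm,
    Real.sqrt_sq (hermiteForm_nonneg hq0.le hq1 (norm_nonneg a) (norm_nonneg b) n)]
  gcongr
  exact norm_hermiteForm_le hq0.le hq1 le_rfl le_rfl n

/-- The `q`-beta integral of Askey, Ismail and Masson. The bounds on `t₁t₃` and `t₂t₄` say that
`χ_{t₁} χ_{t₃}` and `χ_{t₂} χ_{t₄}` have absolutely convergent expansions in `L²(μ)`, and Parseval's
formula reduces the integral to the bilinear generating function. -/
theorem IsMomentSolution.integral_chi_mul {q : ℝ} (hq0 : 0 < q) (hq1 : q < 1) {μ : Measure ℝ}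
    (hμ : IsMomentSolution q μ) {t₁ t₂ t₃ t₄ : ℂ} (h13 : ‖t₁ * t₃‖ < q ^ (3 / 2 : ℝ))
    (h24 : ‖t₂ * t₄‖ < q ^ (3 / 2 : ℝ)) :
    Integrable (fun x => chi q t₁ x * chi q t₂ x * chi q t₃ x * chi q t₄ x) μ ∧
    qPochInf (t₁ * t₂ * t₃ * t₄ * (q : ℂ) ^ (-3 : ℤ)) q *
      ∫ x, chi q t₁ x * chi q t₂ x * chi q t₃ x * chi q t₄ x ∂μ =
    qPochInf (-t₁ * t₂ / q) q *
      (qPochInf (-t₁ * t₃ / q) q * qPochInf (-t₁ * t₄ / q) q * qPochInf (-t₂ * t₃ / q) q *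
        qPochInf (-t₂ * t₄ / q) q * qPochInf (-t₃ * t₄ / q) q) := by
  have hq : (q : ℂ) ≠ 0 := by exact_mod_cast hq0.ne'
  have hqn : ‖(q : ℂ)‖ = q := by rw [Complex.norm_real, Real.norm_of_nonneg hq0.le]
  have hlt : q ^ (3 / 2 : ℝ) < q := by
    simpa using Real.rpow_lt_rpow_of_exponent_gt hq0 hq1 (by norm_num : (1 : ℝ) < 3 / 2)
  have hq3 : q ^ (3 / 2 : ℝ) * q ^ (3 / 2 : ℝ) = q ^ 3 := by
    rw [← Real.rpow_add hq0, ← Real.rpow_natCast]; norm_num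
  set D := qPochInf (-t₁ * t₃ / q) q * qPochInf (-t₂ * t₄ / q) q with hD
  set c : ℕ × ℕ → ℂ := fun p => D * (hermiteForm (q : ℂ) t₁ t₃ p.1 * hermiteForm (q : ℂ) t₂ t₄ p.2)
    with hc
  set F : ℕ × ℕ → ℝ → ℂ := fun p x =>
    c p * ((qInvHermite q x p.1 * qInvHermite q x p.2 : ℝ) : ℂ) with hF
  have hFx (x : ℝ) : ∑' p, F p x = chi q t₁ x * chi q t₂ x * chi q t₃ x * chi q t₄ x := by
    obtain ⟨s1, e1⟩ := chi_mul_chi hq0 hq1 (h13.trans hlt) x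
    obtain ⟨s2, e2⟩ := chi_mul_chi hq0 hq1 (h24.trans hlt) x
    rw [show chi q t₁ x * chi q t₂ x * chi q t₃ x * chi q t₄ x =
      (chi q t₁ x * chi q t₃ x) * (chi q t₂ x * chi q t₄ x) by ring, e1, e2, mul_mul_mul_comm,
      tsum_mul_tsum_of_summable_norm s1 s2, ← tsum_mul_left]
    refine tsum_congr fun p => ?_
    simp only [hF, hc, hD]
    push_cast
    ring
  have hint (p : ℕ × ℕ) : Integrable (F p) μ := (hμ.integrable_mul p.1 p.2).ofReal.const_mul _
  have hsum : Summable fun p => ∫ x, ‖F p x‖ ∂μ := by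
    have s := ((summable_norm_hermiteForm_mul_sqrt hq0 hq1 h13).mul_of_nonneg
      (summable_norm_hermiteForm_mul_sqrt hq0 hq1 h24) (fun n => by positivity)
      (fun n => by positivity)).mul_left ‖D‖
    refine .of_nonneg_of_le (fun p => integral_nonneg fun x => norm_nonneg _) (fun p => ?_) s
    simp only [hF, norm_mul, integral_const_mul, hc, Complex.norm_real]
    have h := hμ.integral_abs_mul_le hq0 hq1 p.1 p.2
    simp only [abs_mul] at h
    simp only [Real.norm_eq_abs]
    calc _ ≤ ‖D‖ * (‖hermiteForm (q : ℂ) t₁ t₃ p.1‖ * ‖hermiteForm (q : ℂ) t₂ t₄ p.2‖) *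
          (√(hermiteWeight q p.1 / q ^ p.1) * √(hermiteWeight q p.2 / q ^ p.2)) := by gcongr
      _ = _ := by ring
  have hmeas : AEStronglyMeasurable (fun x => ∑' p, F p x) μ := by
    simp only [hFx]
    have h := continuous_chi hq0 hq1
    exact ((((h t₁).mul (h t₂)).mul (h t₃)).mul (h t₄)).aestronglyMeasurable
  have i1 := integrable_tsum_of_summable_integral_norm hint hsum hmeas
  have i2 := (hasSum_integral_of_summable_integral_norm hint hsum).tsum_eq
  simp only [hFx] at i1 i2
  refine ⟨i1, ?_⟩
  have hFi (p : ℕ × ℕ) : ∫ x, F p x ∂μ =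
      if p.1 = p.2 then c p * (hermiteWeight (q : ℂ) p.2 / (q : ℂ) ^ p.2) else 0 := by
    simp only [hF]
    rw [integral_const_mul, integral_complex_ofReal, hμ.integral_mul_eq hq0]
    split_ifs
    · simp [ofReal_hermiteWeight]
    · simp
  -- Orthogonality leaves the diagonal; the factors `q⁻ⁿ` are absorbed by homogeneity.
  have hdiag : ∑' p, ∫ x, F p x ∂μ =
      D * mehlerSum q t₁ t₃ ((q : ℂ)⁻¹ * t₂) ((q : ℂ)⁻¹ * t₄) := by
    have hinj : Function.Injective fun n : ℕ => (n, n) := fun m n h => congrArg Prod.fst h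
    rw [← hinj.tsum_eq, mehlerSum, ← tsum_mul_left]
    · refine tsum_congr fun n => ?_
      rw [hFi, if_pos rfl, mehlerTerm, hermiteForm_mul_mul, inv_pow]
      simp only [hc]
      ring
    · rintro ⟨m, n⟩ hp
      rw [Function.mem_support, hFi] at hp
      by_cases hmn : m = n
      · exact ⟨m, by simp [hmn]⟩
      · exact absurd (if_neg hmn) hp
  have hT : t₁ * t₃ * ((q : ℂ)⁻¹ * t₂ * ((q : ℂ)⁻¹ * t₄)) / q =
      t₁ * t₂ * t₃ * t₄ * (q : ℂ) ^ (-3 : ℤ) := by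
    rw [show (-3 : ℤ) = -(3 : ℕ) from rfl, zpow_neg, zpow_natCast]
    field_simp
  have hlt3 : ‖t₁ * t₃ * ((q : ℂ)⁻¹ * t₂ * ((q : ℂ)⁻¹ * t₄))‖ < q := by
    rw [show t₁ * t₃ * ((q : ℂ)⁻¹ * t₂ * ((q : ℂ)⁻¹ * t₄)) = (t₁ * t₃) * (t₂ * t₄) / (q : ℂ) ^ 2 by
      field_simp, norm_div, norm_mul, norm_pow, hqn, div_lt_iff₀ (by positivity)]
    calc _ < q ^ (3 / 2 : ℝ) * q ^ (3 / 2 : ℝ) :=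
          mul_lt_mul'' h13 h24 (norm_nonneg _) (norm_nonneg _)
      _ = q * q ^ 2 := by rw [hq3]; ring
  have hM := mehler_formula hq0 hq1 hlt3
  rw [hT] at hM
  rw [← i2, hdiag, mul_left_comm, hM, hD,
    show -t₁ * ((q : ℂ)⁻¹ * t₂) = -t₁ * t₂ / q by ring,
    show -t₁ * ((q : ℂ)⁻¹ * t₄) = -t₁ * t₄ / q by ring,
    show -t₃ * ((q : ℂ)⁻¹ * t₂) = -t₂ * t₃ / q by ring,
    show -t₃ * ((q : ℂ)⁻¹ * t₄) = -t₃ * t₄ / q by ring]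
  ring

/-! ### Terminating sums -/

section Terminating

variable {K : Type*} [Field K] {q : K}

/-- `(q⁻ᵐ; q)_k q^k / (q; q)_k`, the coefficients of the terminating sums in base `q`. -/
def termCoeff (q : K) (m k : ℕ) : K :=
  qPoch (q ^ (-(m : ℤ))) q k / qPoch q q k * q ^ k

theorem qPoch_self_ne_zero (hn : ∀ n : ℕ, 1 - q ^ (n + 1) ≠ 0) (k : ℕ) : qPoch q q k ≠ 0 :=
  Finset.prod_ne_zero_iff.2 fun n _ => by rw [← pow_succ']; exact hn n

theorem qPoch_neg_pow_eq_zero (hq : q ≠ 0) {m k : ℕ} (h : m < k) :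
    qPoch (q ^ (-(m : ℤ))) q k = 0 :=
  qPoch_eq_zero_of_mul_pow_eq_one h
    (by rw [zpow_neg, zpow_natCast, inv_mul_cancel₀ (pow_ne_zero _ hq)])

theorem termCoeff_eq_zero (hq : q ≠ 0) {m k : ℕ} (h : m < k) : termCoeff q m k = 0 := by
  rw [termCoeff, qPoch_neg_pow_eq_zero hq h, zero_div, zero_mul]

@[simp] theorem termCoeff_zero_right (q : K) (m : ℕ) : termCoeff q m 0 = 1 := by simp [termCoeff]

/-- The analogue of Pascal's rule for these coefficients. -/
theorem termCoeff_succ_succ (hq : q ≠ 0) (hn : ∀ n : ℕ, 1 - q ^ (n + 1) ≠ 0) (m k : ℕ) :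
    termCoeff q (m + 1) (k + 1) = termCoeff q m (k + 1) - q ^ (-(m : ℤ)) * termCoeff q m k := by
  have h1 : q ^ (-((m + 1 : ℕ) : ℤ)) * q = q ^ (-(m : ℤ)) := by
    rw [← zpow_add_one₀ hq]; congr 1; push_cast; ring
  have h2 := qPoch_self_ne_zero hn k
  have h3 := hn k
  rw [termCoeff, termCoeff, termCoeff, qPoch_succ' (q ^ (-((m + 1 : ℕ) : ℤ))), h1,
    qPoch_succ (q ^ (-(m : ℤ))), qPoch_succ q q k, ← pow_succ', ← h1]
  field_simp
  ring

theorem sum_termCoeff_succ (hq : q ≠ 0) (hn : ∀ n : ℕ, 1 - q ^ (n + 1) ≠ 0) (m : ℕ) (G : ℕ → K) :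
    ∑ k ∈ Finset.range (m + 2), termCoeff q (m + 1) k * G k =
      ∑ k ∈ Finset.range (m + 1), termCoeff q m k * (G k - q ^ (-(m : ℤ)) * G (k + 1)) := by
  have h1 : ∑ k ∈ Finset.range (m + 1), termCoeff q m k * G k =
      ∑ k ∈ Finset.range (m + 2), termCoeff q m k * G k := by
    rw [Finset.sum_range_succ _ (m + 1), termCoeff_eq_zero hq (Nat.lt_succ_self m), zero_mul,
      add_zero]
  simp only [mul_sub, Finset.sum_sub_distrib]
  rw [h1, Finset.sum_range_succ' _ (m + 1), Finset.sum_range_succ' _ (m + 1), add_sub_right_comm,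
    ← Finset.sum_sub_distrib]
  simp only [termCoeff_zero_right, termCoeff_succ_succ hq hn]
  congr 1
  exact Finset.sum_congr rfl fun k _ => by ring

/-- The sum with coefficients `termCoeff q m` annihilates the powers of `q^k` below the `m`-th. -/
theorem sum_termCoeff_mul_pow (hq : q ≠ 0) (hn : ∀ n : ℕ, 1 - q ^ (n + 1) ≠ 0) {m i : ℕ}
    (h : i < m) : ∑ k ∈ Finset.range (m + 1), termCoeff q m k * (q ^ k) ^ i = 0 := by
  induction m with
  | zero => omega
  | succ m ih =>
    rw [sum_termCoeff_succ hq hn]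
    have e : ∑ k ∈ Finset.range (m + 1),
        termCoeff q m k * ((q ^ k) ^ i - q ^ (-(m : ℤ)) * (q ^ (k + 1)) ^ i) =
        (1 - q ^ (-(m : ℤ)) * q ^ i) *
          ∑ k ∈ Finset.range (m + 1), termCoeff q m k * (q ^ k) ^ i := by
      rw [Finset.mul_sum]
      exact Finset.sum_congr rfl fun k _ => by ring
    rw [e]
    rcases Nat.lt_succ_iff_lt_or_eq.1 h with h | rfl
    · rw [ih h, mul_zero]
    · rw [zpow_neg, zpow_natCast, inv_mul_cancel₀ (pow_ne_zero _ hq), sub_self, zero_mul]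

/-- If a functional annihilates the powers of `q^k` below the `N`-th, its product with the polynomial
`(a q^k; q)_j` of degree `j` annihilates those below the `(N - j)`-th. -/
theorem sum_mul_qPoch_eq_zero {s : Finset ℕ} {G : ℕ → K} {N : ℕ}
    (hG : ∀ i < N, ∑ k ∈ s, G k * (q ^ k) ^ i = 0) (a : K) (j : ℕ) {i : ℕ} (h : i + j < N) :
    ∑ k ∈ s, G k * qPoch (a * q ^ k) q j * (q ^ k) ^ i = 0 := by
  induction j generalizing i with
  | zero => simpa using hG i h
  | succ j ih =>
    have e : ∑ k ∈ s, G k * qPoch (a * q ^ k) q (j + 1) * (q ^ k) ^ i =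
        ∑ k ∈ s, G k * qPoch (a * q ^ k) q j * (q ^ k) ^ i
          - a * q ^ j * ∑ k ∈ s, G k * qPoch (a * q ^ k) q j * (q ^ k) ^ (i + 1) := by
      rw [Finset.mul_sum, ← Finset.sum_sub_distrib]
      exact Finset.sum_congr rfl fun k _ => by rw [qPoch_succ]; ring
    rw [e, ih (by omega), ih (by omega), mul_zero, sub_zero]

theorem sum_termCoeff_mul_qPoch_mul_qPoch (hq : q ≠ 0) (hn : ∀ n : ℕ, 1 - q ^ (n + 1) ≠ 0)
    (a b : K) {m j l : ℕ} (h : j + l < m) : ∑ k ∈ Finset.range (m + 1),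
      termCoeff q m k * qPoch (a * q ^ k) q j * qPoch (b * q ^ k) q l = 0 := by
  have h1 (i : ℕ) (hi : i < m - j) : ∑ k ∈ Finset.range (m + 1),
      termCoeff q m k * qPoch (a * q ^ k) q j * (q ^ k) ^ i = 0 :=
    sum_mul_qPoch_eq_zero (fun i hi => sum_termCoeff_mul_pow hq hn hi) a j (by omega)
  simpa using sum_mul_qPoch_eq_zero h1 b l (i := 0) (by omega)

/-- The case `a = 0` of the `q`-Saalschütz sum below. -/
theorem sum_termCoeff_mul_qPoch (hq : q ≠ 0) (hn : ∀ n : ℕ, 1 - q ^ (n + 1) ≠ 0) (b : K) (m : ℕ) :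
    ∑ k ∈ Finset.range (m + 1),
      termCoeff q m k * (qPoch b q k * qPoch (b * q ^ (k + 1)) q (m - k)) = qPoch q q m * b ^ m := by
  induction m generalizing b with
  | zero => simp
  | succ m ih =>
    have hm : q ^ (-(m : ℤ)) * q ^ m = 1 := by
      rw [zpow_neg, zpow_natCast, inv_mul_cancel₀ (pow_ne_zero _ hq)]
    have e : ∑ k ∈ Finset.range (m + 1), termCoeff q m k *
        (qPoch b q k * qPoch (b * q ^ (k + 1)) q (m + 1 - k) - q ^ (-(m : ℤ)) *
          (qPoch b q (k + 1) * qPoch (b * q ^ (k + 1 + 1)) q (m + 1 - (k + 1)))) =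
        (1 - b * q ^ (m + 1)) * ∑ k ∈ Finset.range (m + 1),
          termCoeff q m k * (qPoch b q k * qPoch (b * q ^ (k + 1)) q (m - k))
        - q ^ (-(m : ℤ)) * (1 - b) * ∑ k ∈ Finset.range (m + 1),
          termCoeff q m k * (qPoch (b * q) q k * qPoch (b * q * q ^ (k + 1)) q (m - k)) := by
      rw [Finset.mul_sum, Finset.mul_sum, ← Finset.sum_sub_distrib]
      refine Finset.sum_congr rfl fun k hk => ?_
      obtain ⟨l, rfl⟩ := Nat.exists_eq_add_of_le (Finset.mem_range_succ_iff.1 hk)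
      rw [show k + l + 1 - k = l + 1 by omega, show k + l + 1 - (k + 1) = l by omega,
        Nat.add_sub_cancel_left, qPoch_succ, qPoch_succ' b q k,
        show b * q ^ (k + 1 + 1) = b * q * q ^ (k + 1) by ring]
      ring
    rw [sum_termCoeff_succ hq hn, e, ih, ih, qPoch_succ q q m, mul_pow]
    linear_combination (-(1 - b) * qPoch q q m * b ^ m) * hm

/-- A polynomial form of the `q`-Saalschütz sum, in which no denominator can vanish. -/
theorem mul_sum_termCoeff_mul_qPoch_mul (hq : q ≠ 0) (hn : ∀ n : ℕ, 1 - q ^ (n + 1) ≠ 0)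
    {b : K} (hb : b ≠ 0) (a : K) {m j : ℕ} (h : j ≤ m) :
    ∑ k ∈ Finset.range (m + 1), termCoeff q m k * qPoch (a * q ^ k) q j *
      (qPoch b q k * qPoch (b * q ^ (k + 1)) q (m - k)) =
    qPoch q q m * b ^ (m - j) * ∏ l ∈ Finset.range j, (b - a * q ^ l) := by
  induction j with
  | zero => simpa using sum_termCoeff_mul_qPoch hq hn b m
  | succ j ih =>
    refine mul_left_cancel₀ hb ?_
    have h0 := sum_termCoeff_mul_qPoch_mul_qPoch hq hn a 0 (m := m) (j := j) (l := 0) (by omega)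
    simp only [qPoch_zero, mul_one] at h0
    -- Here `b (1 - a q^{j+k}) = (b - a q^j) + a q^j (1 - b q^k)` is used.
    have e : b * ∑ k ∈ Finset.range (m + 1), termCoeff q m k * qPoch (a * q ^ k) q (j + 1) *
        (qPoch b q k * qPoch (b * q ^ (k + 1)) q (m - k)) =
        (b - a * q ^ j) * ∑ k ∈ Finset.range (m + 1), termCoeff q m k * qPoch (a * q ^ k) q j *
          (qPoch b q k * qPoch (b * q ^ (k + 1)) q (m - k))
        + a * q ^ j * qPoch b q (m + 1) *
          ∑ k ∈ Finset.range (m + 1), termCoeff q m k * qPoch (a * q ^ k) q j := by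
      rw [Finset.mul_sum, Finset.mul_sum, Finset.mul_sum, ← Finset.sum_add_distrib]
      refine Finset.sum_congr rfl fun k hk => ?_
      obtain ⟨l, rfl⟩ := Nat.exists_eq_add_of_le (Finset.mem_range_succ_iff.1 hk)
      rw [Nat.add_sub_cancel_left, show k + l + 1 = k + 1 + l by omega, qPoch_add b, qPoch_succ b,
        qPoch_succ (a * q ^ k)]
      ring
    rw [e, h0, ih (by omega), Finset.prod_range_succ, show m - j = m - (j + 1) + 1 by omega]
    ring

end Terminating

/-- The case `j = m` of `mul_sum_termCoeff_mul_qPoch_mul`, where `b = 0` is admitted as well. -/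
theorem sum_termCoeff_mul_qPoch_mul {q : ℂ} (hq : q ≠ 0) (hn : ∀ n : ℕ, 1 - q ^ (n + 1) ≠ 0)
    (a b : ℂ) (m : ℕ) :
    ∑ k ∈ Finset.range (m + 1), termCoeff q m k * qPoch (a * q ^ k) q m *
      (qPoch b q k * qPoch (b * q ^ (k + 1)) q (m - k)) =
    qPoch q q m * ∏ l ∈ Finset.range m, (b - a * q ^ l) := by
  -- Both sides are polynomials in `b`, so that the case `b = 0` follows by continuity.
  have h := Continuous.ext_on (dense_compl_singleton (0 : ℂ))
    (f := fun b => ∑ k ∈ Finset.range (m + 1), termCoeff q m k * qPoch (a * q ^ k) q m *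
      (qPoch b q k * qPoch (b * q ^ (k + 1)) q (m - k)))
    (g := fun b => qPoch q q m * ∏ l ∈ Finset.range m, (b - a * q ^ l))
    (by unfold qPoch; fun_prop) (by fun_prop)
    (fun b hb => by simpa using mul_sum_termCoeff_mul_qPoch_mul hq hn hb a le_rfl)
  exact congrFun h b

/-- The sum vanishes because `(e q^l; q)_k (e q^k; q)_∞ = (e q^l; q)_∞ (e q^k; q)_l` is a
polynomial of degree `l` in `q^k`. -/
theorem sum_termCoeff_mul_qPochInf_eq_zero {q : ℂ} (hq : q ≠ 0) (hq1 : ‖q‖ < 1)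
    (hn : ∀ n : ℕ, 1 - q ^ (n + 1) ≠ 0) (a e : ℂ) {m j l : ℕ} (h : j + l < m) :
    ∑ k ∈ Finset.range (m + 1), termCoeff q m k * qPoch (a * q ^ k) q j *
      (qPoch (e * q ^ l) q k * qPochInf (e * q ^ k) q) = 0 := by
  have h1 := sum_termCoeff_mul_qPoch_mul_qPoch hq hn a e h
  rw [← zero_mul (qPochInf (e * q ^ l) q), ← h1, Finset.sum_mul]
  refine Finset.sum_congr rfl fun k _ => ?_
  rw [qPochInf_eq_qPoch_mul (e * q ^ k) hq1 l, qPochInf_eq_qPoch_mul (e * q ^ l) hq1 k,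
    mul_right_comm e]
  ring

theorem sum_termCoeff_mul_qPochInf {q : ℂ} (hq : q ≠ 0) (hq1 : ‖q‖ < 1)
    (hn : ∀ n : ℕ, 1 - q ^ (n + 1) ≠ 0) (a b : ℂ) (m : ℕ) :
    ∑ k ∈ Finset.range (m + 1), termCoeff q m k * qPoch (a * q ^ k) q m *
      (qPoch b q k * qPochInf (b * q ^ (k + 1)) q) =
    qPoch q q m * (∏ l ∈ Finset.range m, (b - a * q ^ l)) * qPochInf (b * q ^ (m + 1)) q := by
  rw [← sum_termCoeff_mul_qPoch_mul hq hn, Finset.sum_mul]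
  refine Finset.sum_congr rfl fun k hk => ?_
  obtain ⟨l, rfl⟩ := Nat.exists_eq_add_of_le (Finset.mem_range_succ_iff.1 hk)
  rw [Nat.add_sub_cancel_left, qPochInf_eq_qPoch_mul (b * q ^ (k + 1)) hq1 l, mul_assoc b,
    ← pow_add, show k + 1 + l = k + l + 1 by omega]
  ring

theorem termCoeff_self {q : ℂ} (hq : q ≠ 0) (hn : ∀ n : ℕ, 1 - q ^ (n + 1) ≠ 0) (n : ℕ) :
    termCoeff q n n = ∏ k ∈ Finset.range n, (-(q ^ k)⁻¹) := by
  induction n with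
  | zero => simp
  | succ n ih =>
    rw [termCoeff_succ_succ hq hn, termCoeff_eq_zero hq (Nat.lt_succ_self n), ih,
      Finset.prod_range_succ, zpow_neg, zpow_natCast]
    ring

/-- The factors `-q^{-l}` of `termCoeff q n n` turn the product into the one of the norm,
reversed. -/
theorem termCoeff_self_mul_prod {q : ℂ} (hq : q ≠ 0) (hn : ∀ n : ℕ, 1 - q ^ (n + 1) ≠ 0) (u a : ℂ)
    (n : ℕ) : termCoeff q n n * ∏ l ∈ Finset.range n, (-u * q ^ ((n : ℤ) - 2) - a * q ^ l) =
      ∏ k ∈ Finset.range n, (a + u * q ^ ((k : ℤ) - 1)) := by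
  rw [termCoeff_self hq hn, ← Finset.prod_mul_distrib, ← Finset.prod_range_reflect]
  refine Finset.prod_congr rfl fun k hk => ?_
  have hk := Finset.mem_range.1 hk
  obtain ⟨l, rfl⟩ : ∃ l, n = k + l + 1 := ⟨n - k - 1, by omega⟩
  have h : (q : ℂ) ^ (((k + l + 1 : ℕ) : ℤ) - 2) = q ^ ((k : ℤ) - 1) * q ^ l := by
    rw [← zpow_natCast q l, ← zpow_add₀ hq]; congr 1; push_cast; ring
  rw [show k + l + 1 - 1 - k = l by omega, h]
  field_simp
  ring

/-! ### Biorthogonality -/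

theorem sum_termCoeff_mul_qPochInf_zpow_eq_zero {q : ℂ} (hq : q ≠ 0) (hq1 : ‖q‖ < 1)
    (hn : ∀ n : ℕ, 1 - q ^ (n + 1) ≠ 0) (u T : ℂ) {m j : ℕ} (h : j < m) :
    ∑ k ∈ Finset.range (m + 1), termCoeff q m k * qPoch (T * q ^ k) q j *
      (qPoch (-u * q ^ ((m : ℤ) - 2)) q k * qPochInf (-u * q ^ ((k : ℤ) + j - 1)) q) = 0 := by
  obtain ⟨l, rfl⟩ : ∃ l, m = j + l + 1 := ⟨m - j - 1, by omega⟩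
  have h1 : -u * q ^ (((j + l + 1 : ℕ) : ℤ) - 2) = -u * q ^ ((j : ℤ) - 1) * q ^ l := by
    rw [mul_assoc, ← zpow_natCast q l, ← zpow_add₀ hq]; congr 2; push_cast; ring
  have h2 (k : ℕ) : -u * q ^ ((k : ℤ) + j - 1) = -u * q ^ ((j : ℤ) - 1) * q ^ k := by
    rw [mul_assoc, ← zpow_natCast q k, ← zpow_add₀ hq]; congr 2; ring
  simp only [h1, h2]
  exact sum_termCoeff_mul_qPochInf_eq_zero hq hq1 hn _ _ (by omega)

theorem sum_termCoeff_mul_qPochInf_zpow {q : ℂ} (hq : q ≠ 0) (hq1 : ‖q‖ < 1)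
    (hn : ∀ n : ℕ, 1 - q ^ (n + 1) ≠ 0) (u T : ℂ) (m : ℕ) :
    ∑ k ∈ Finset.range (m + 1), termCoeff q m k * qPoch (T * q ^ k) q m *
      (qPoch (-u * q ^ ((m : ℤ) - 2)) q k * qPochInf (-u * q ^ ((k : ℤ) + m - 1)) q) =
    qPoch q q m * (∏ l ∈ Finset.range m, (-u * q ^ ((m : ℤ) - 2) - T * q ^ l)) *
      qPochInf (-u * q ^ (2 * (m : ℤ) - 1)) q := by
  have h2 (k : ℕ) : -u * q ^ ((k : ℤ) + m - 1) = -u * q ^ ((m : ℤ) - 2) * q ^ (k + 1) := by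
    rw [mul_assoc, ← zpow_natCast q (k + 1), ← zpow_add₀ hq]; congr 2; push_cast; ring
  rw [show 2 * (m : ℤ) - 1 = (m : ℤ) + m - 1 by ring]
  simp only [h2]
  exact sum_termCoeff_mul_qPochInf hq hq1 hn _ _ _

/-- The double sum to which the biorthogonality integral reduces, up to a factor that does not depend
on `m` and `n`, with `u = t₁t₂` and `T = t₁t₂t₃t₄q⁻³`. -/
def biorthSum (q u T : ℂ) (m n : ℕ) : ℂ :=
  ∑ k ∈ Finset.range (m + 1), ∑ j ∈ Finset.range (n + 1),
    (termCoeff q m k * (qPoch (-u * q ^ ((m : ℤ) - 2)) q k / qPoch T q k)) *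
    (termCoeff q n j * (qPoch (-u * q ^ ((n : ℤ) - 2)) q j / qPoch T q j)) *
    (qPoch T q (k + j) * qPochInf (-u * q ^ ((k : ℤ) + j - 1)) q)

theorem biorthSum_comm (q u T : ℂ) (m n : ℕ) : biorthSum q u T m n = biorthSum q u T n m := by
  rw [biorthSum, Finset.sum_comm, biorthSum]
  refine Finset.sum_congr rfl fun k _ => Finset.sum_congr rfl fun j _ => ?_
  rw [add_comm j k, add_comm (j : ℤ) k]
  ring

/-- The inner sums are of Saalschütz type, as `(T; q)_{k+j} / (T; q)_k = (T q^k; q)_j`. -/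
theorem biorthSum_eq_sum {q T : ℂ} (hT : ∀ n, qPoch T q n ≠ 0) (u : ℂ) (m n : ℕ) :
    biorthSum q u T m n = ∑ j ∈ Finset.range (n + 1),
      termCoeff q n j * (qPoch (-u * q ^ ((n : ℤ) - 2)) q j / qPoch T q j) *
      ∑ k ∈ Finset.range (m + 1), termCoeff q m k * qPoch (T * q ^ k) q j *
        (qPoch (-u * q ^ ((m : ℤ) - 2)) q k * qPochInf (-u * q ^ ((k : ℤ) + j - 1)) q) := by
  rw [biorthSum, Finset.sum_comm]
  refine Finset.sum_congr rfl fun j _ => ?_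
  rw [Finset.mul_sum]
  refine Finset.sum_congr rfl fun k _ => ?_
  have := hT k
  have := hT j
  rw [qPoch_add]
  field_simp

theorem biorthSum_eq_zero {q T : ℂ} (hq : q ≠ 0) (hq1 : ‖q‖ < 1)
    (hn : ∀ n : ℕ, 1 - q ^ (n + 1) ≠ 0) (hT : ∀ n, qPoch T q n ≠ 0) (u : ℂ) {m n : ℕ}
    (h : m ≠ n) : biorthSum q u T m n = 0 := by
  wlog hlt : n < m generalizing m n
  · rw [biorthSum_comm]
    exact this h.symm (by omega)
  rw [biorthSum_eq_sum hT]
  refine Finset.sum_eq_zero fun j hj => ?_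
  have hj := Finset.mem_range.1 hj
  rw [sum_termCoeff_mul_qPochInf_zpow_eq_zero hq hq1 hn u T (by omega), mul_zero]

theorem biorthSum_self {q T : ℂ} (hq : q ≠ 0) (hq1 : ‖q‖ < 1)
    (hn : ∀ n : ℕ, 1 - q ^ (n + 1) ≠ 0) (hT : ∀ n, qPoch T q n ≠ 0) (u : ℂ) (n : ℕ) :
    biorthSum q u T n n =
      qPoch q q n * (∏ k ∈ Finset.range n, (T + u * q ^ ((k : ℤ) - 1))) *
        qPoch (-u * q ^ ((n : ℤ) - 2)) q n * qPochInf (-u * q ^ (2 * (n : ℤ) - 1)) q /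
        qPoch T q n := by
  rw [biorthSum_eq_sum hT, Finset.sum_range_succ, Finset.sum_eq_zero, zero_add,
    sum_termCoeff_mul_qPochInf_zpow hq hq1 hn, ← termCoeff_self_mul_prod hq hn]
  · ring
  · intro j hj
    rw [sum_termCoeff_mul_qPochInf_zpow_eq_zero hq hq1 hn u T (Finset.mem_range.1 hj), mul_zero]

/-- The coefficients in the expansion of `φ_n(x; t₁, t₂, t₃, t₄) χ_{t₁}(x)` in the
functions `χ_{t₁ q^k}(x)`. -/
def phiCoeff (q : ℝ) (n : ℕ) (t₁ t₂ t₃ t₄ : ℂ) (k : ℕ) : ℂ :=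
  termCoeff (q : ℂ) n k * (qPoch (-(t₁ * t₂) * (q : ℂ) ^ ((n : ℤ) - 2)) q k *
    qPoch (-t₁ * t₃ / q) q k * qPoch (-t₁ * t₄ / q) q k /
    qPoch (t₁ * t₂ * t₃ * t₄ * (q : ℂ) ^ (-3 : ℤ)) q k)

theorem chi_eq_qPoch_mul {q : ℝ} (hq0 : 0 < q) (hq1 : q < 1) (t : ℂ) (x : ℝ) (k : ℕ) :
    chi q t x = qPoch (-t * expXi x) (q : ℂ) k * qPoch (t * expNegXi x) (q : ℂ) k *
      chi q (t * (q : ℂ) ^ k) x := by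
  have h := norm_ofReal_lt_one hq0 hq1
  rw [chi, chi, qPochInf_eq_qPoch_mul (-t * expXi x) h k,
    qPochInf_eq_qPoch_mul (t * expNegXi x) h k, mul_right_comm (-t), mul_right_comm t,
    neg_mul t (_ ^ k)]
  ring

theorem qPoch_ne_zero_of_le {a q : ℂ} {k n : ℕ} (h : k ≤ n) (hn : qPoch a q n ≠ 0) :
    qPoch a q k ≠ 0 := by
  obtain ⟨l, rfl⟩ := Nat.exists_eq_add_of_le h
  rw [qPoch_add] at hn
  exact left_ne_zero_of_mul hn

/-- Multiplication by `χ_{t₁}` cancels the denominators of `φ_n` that depend on `x`. -/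
theorem phi4_mul_chi {q : ℝ} (hq0 : 0 < q) (hq1 : q < 1) (n : ℕ) (t₁ t₂ t₃ t₄ : ℂ) {x : ℝ}
    (hx : x ∉ poles q n t₁) : phi4 q n t₁ t₂ t₃ t₄ x * chi q t₁ x =
      ∑ k ∈ Finset.range (n + 1), phiCoeff q n t₁ t₂ t₃ t₄ k * chi q (t₁ * (q : ℂ) ^ k) x := by
  have hq : (q : ℂ) ≠ 0 := by exact_mod_cast hq0.ne'
  rw [phi4, basicHypergeometric, tsum_eq_sum (s := Finset.range (n + 1)), Finset.sum_mul]
  · refine Finset.sum_congr rfl fun k hk => ?_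
    have hk := Finset.mem_range_succ_iff.1 hk
    have hx : ¬ _ = _ := hx
    rw [mul_eq_zero, not_or] at hx
    have h1 := qPoch_ne_zero_of_le hk hx.1
    have h2 := qPoch_ne_zero_of_le hk hx.2
    rw [chi_eq_qPoch_mul hq0 hq1 t₁ x k, phiCoeff, termCoeff]
    simp only [List.map_cons, List.map_nil, List.prod_cons, List.prod_nil, List.length_cons,
      List.length_nil, mul_one]
    norm_num only [zpow_zero, mul_one]
    rw [neg_mul t₁ t₂]
    set P := qPoch (-t₁ * expXi x) (q : ℂ) k
    set Q := qPoch (t₁ * expNegXi x) (q : ℂ) k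
    refine Eq.trans ?_ (div_mul_cancel₀ _ (mul_ne_zero h1 h2))
    ring
  · intro k hk
    have hk : n < k := by simpa using hk
    simp [qPoch_neg_pow_eq_zero hq hk, -zpow_neg, -zpow_natCast]

theorem finite_poles {q : ℝ} (hq0 : 0 < q) (n : ℕ) (t : ℂ) : (poles q n t).Finite := by
  have hq : (q : ℂ) ≠ 0 := by exact_mod_cast hq0.ne'
  have hinj : Function.Injective expXi := fun x y h =>
    Real.arsinh_injective (Real.exp_injective (Complex.ofReal_injective h))
  have hinj' : Function.Injective expNegXi := fun x y h =>
    Real.arsinh_injective (neg_injective (Real.exp_injective (Complex.ofReal_injective h)))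
  have key (g : ℝ → ℂ) (hg : Function.Injective g) (s : ℂ) :
      {x | qPoch (s * g x) (q : ℂ) n = 0}.Finite := by
    refine Set.Finite.subset ((Finset.range n).finite_toSet.biUnion
      (t := fun k => {x | s * g x * (q : ℂ) ^ k = 1}) fun k _ => ?_) ?_
    · refine Set.Subsingleton.finite fun x hx y hy => hg ?_
      have hx : s * g x * (q : ℂ) ^ k = 1 := hx
      have hy : s * g y * (q : ℂ) ^ k = 1 := hy
      have hs : s * (q : ℂ) ^ k ≠ 0 := by
        rintro h
        rw [mul_right_comm, h, zero_mul] at hx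
        exact zero_ne_one hx
      exact mul_left_cancel₀ hs (by rw [mul_right_comm, hx, mul_right_comm, hy])
    · intro x hx
      obtain ⟨k, hk, h⟩ := Finset.prod_eq_zero_iff.1 (show qPoch (s * g x) (q : ℂ) n = 0 from hx)
      exact Set.mem_biUnion hk (sub_eq_zero.1 h).symm
  refine ((key _ hinj (-t)).union (key _ hinj' t)).subset fun x hx => ?_
  exact mul_eq_zero.1 hx

theorem norm_mul_zpow_neg_three_lt_one {q : ℝ} (hq0 : 0 < q) {t₁ t₂ t₃ t₄ : ℂ}
    (h13 : ‖t₁ * t₃‖ < q ^ (3 / 2 : ℝ)) (h24 : ‖t₂ * t₄‖ < q ^ (3 / 2 : ℝ)) :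
    ‖t₁ * t₂ * t₃ * t₄ * (q : ℂ) ^ (-3 : ℤ)‖ < 1 := by
  have hqn : ‖(q : ℂ)‖ = q := by rw [Complex.norm_real, Real.norm_of_nonneg hq0.le]
  have hq3 : q ^ (3 / 2 : ℝ) * q ^ (3 / 2 : ℝ) = q ^ 3 := by
    rw [← Real.rpow_add hq0, ← Real.rpow_natCast]; norm_num
  rw [show t₁ * t₂ * t₃ * t₄ = (t₁ * t₃) * (t₂ * t₄) by ring, show (-3 : ℤ) = -(3 : ℕ) from rfl,
    zpow_neg, zpow_natCast, ← div_eq_mul_inv, norm_div, norm_mul, norm_pow, hqn,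
    div_lt_one (by positivity), ← hq3]
  exact mul_lt_mul'' h13 h24 (norm_nonneg _) (norm_nonneg _)

/-- The terms of the biorthogonality integral are the terms of `biorthSum`, up to a common factor. -/
theorem phiCoeff_mul_phiCoeff_mul_integral {q : ℝ} (hq0 : 0 < q) (hq1 : q < 1) {μ : Measure ℝ}
    (hμ : IsMomentSolution q μ) {t₁ t₂ t₃ t₄ : ℂ} (h13 : ‖t₁ * t₃‖ < q ^ (3 / 2 : ℝ))
    (h24 : ‖t₂ * t₄‖ < q ^ (3 / 2 : ℝ)) (m n k j : ℕ) :
    Integrable (fun x => chi q (t₁ * (q : ℂ) ^ k) x * chi q (t₂ * (q : ℂ) ^ j) x *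
      chi q t₃ x * chi q t₄ x) μ ∧
    phiCoeff q m t₁ t₂ t₃ t₄ k * phiCoeff q n t₂ t₁ t₃ t₄ j *
      ∫ x, chi q (t₁ * (q : ℂ) ^ k) x * chi q (t₂ * (q : ℂ) ^ j) x *
        chi q t₃ x * chi q t₄ x ∂μ =
    (qPochInf (-t₁ * t₃ / q) q * qPochInf (-t₁ * t₄ / q) q * qPochInf (-t₂ * t₃ / q) q *
        qPochInf (-t₂ * t₄ / q) q * qPochInf (-t₃ * t₄ / q) q /
        qPochInf (t₁ * t₂ * t₃ * t₄ * (q : ℂ) ^ (-3 : ℤ)) q) *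
      ((termCoeff (q : ℂ) m k * (qPoch (-(t₁ * t₂) * (q : ℂ) ^ ((m : ℤ) - 2)) q k /
          qPoch (t₁ * t₂ * t₃ * t₄ * (q : ℂ) ^ (-3 : ℤ)) q k)) *
        (termCoeff (q : ℂ) n j * (qPoch (-(t₁ * t₂) * (q : ℂ) ^ ((n : ℤ) - 2)) q j /
          qPoch (t₁ * t₂ * t₃ * t₄ * (q : ℂ) ^ (-3 : ℤ)) q j)) *
        (qPoch (t₁ * t₂ * t₃ * t₄ * (q : ℂ) ^ (-3 : ℤ)) q (k + j) *
          qPochInf (-(t₁ * t₂) * (q : ℂ) ^ ((k : ℤ) + j - 1)) q)) := by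
  have hq : (q : ℂ) ≠ 0 := by exact_mod_cast hq0.ne'
  have hn1 := norm_ofReal_lt_one hq0 hq1
  have h13' : ‖t₁ * (q : ℂ) ^ k * t₃‖ < q ^ (3 / 2 : ℝ) := by
    rw [mul_right_comm]; exact (norm_mul_ofReal_pow_le hq0 hq1 _ k).trans_lt h13
  have h24' : ‖t₂ * (q : ℂ) ^ j * t₄‖ < q ^ (3 / 2 : ℝ) := by
    rw [mul_right_comm]; exact (norm_mul_ofReal_pow_le hq0 hq1 _ j).trans_lt h24
  obtain ⟨h1, h2⟩ := hμ.integral_chi_mul hq0 hq1 h13' h24'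
  refine ⟨h1, ?_⟩
  have hT := norm_mul_zpow_neg_three_lt_one hq0 h13 h24
  rw [phiCoeff, phiCoeff, mul_comm t₂ t₁]
  have e1 : t₁ * (q : ℂ) ^ k * (t₂ * (q : ℂ) ^ j) * t₃ * t₄ * (q : ℂ) ^ (-3 : ℤ) =
      t₁ * t₂ * t₃ * t₄ * (q : ℂ) ^ (-3 : ℤ) * (q : ℂ) ^ (k + j) := by rw [pow_add]; ring
  have e2 : -(t₁ * (q : ℂ) ^ k) * (t₂ * (q : ℂ) ^ j) / q =
      -(t₁ * t₂) * (q : ℂ) ^ ((k : ℤ) + j - 1) := by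
    rw [zpow_sub_one₀ hq, zpow_add₀ hq, zpow_natCast, zpow_natCast]; ring
  have e3 (t s : ℂ) (i : ℕ) : -(t * (q : ℂ) ^ i) * s / q = -t * s / q * (q : ℂ) ^ i := by ring
  rw [e1, e2, e3, e3, e3, e3] at h2
  set T := t₁ * t₂ * t₃ * t₄ * (q : ℂ) ^ (-3 : ℤ)
  have hT0 := qPochInf_ne_zero hT hn1
  rw [qPochInf_eq_qPoch_mul T hn1 (k + j)] at hT0 ⊢
  have hTkj := qPoch_ne_zero hT hn1.le (k + j)
  have hT1 := right_ne_zero_of_mul hT0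
  rw [mul_comm (qPochInf _ _), ← eq_div_iff hT1] at h2
  rw [h2, qPochInf_eq_qPoch_mul (-t₁ * t₃ / q) hn1 k, qPochInf_eq_qPoch_mul (-t₁ * t₄ / q) hn1 k,
    qPochInf_eq_qPoch_mul (-t₂ * t₃ / q) hn1 j, qPochInf_eq_qPoch_mul (-t₂ * t₄ / q) hn1 j]
  refine (mul_div_cancel_right₀ _ hTkj).symm.trans ?_
  ring

theorem hasExtendedIntegral_phi4 {q : ℝ} (hq0 : 0 < q) (hq1 : q < 1) {μ : Measure ℝ}
    (hμ : IsMomentSolution q μ) {t₁ t₂ t₃ t₄ : ℂ} (h13 : ‖t₁ * t₃‖ < q ^ (3 / 2 : ℝ))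
    (h24 : ‖t₂ * t₄‖ < q ^ (3 / 2 : ℝ)) (m n : ℕ) :
    HasExtendedIntegral μ (poles q m t₁ ∪ poles q n t₂)
      (fun x => phi4 q m t₁ t₂ t₃ t₄ x * phi4 q n t₂ t₁ t₃ t₄ x *
        (chi q t₁ x * chi q t₂ x * chi q t₃ x * chi q t₄ x))
      (if m = n then normConst q n t₁ t₂ t₃ t₄ else 0) := by
  have hq : (q : ℂ) ≠ 0 := by exact_mod_cast hq0.ne'
  have hn1 := norm_ofReal_lt_one hq0 hq1
  have hn := one_sub_ofReal_pow_ne_zero hq0 hq1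
  have hT := norm_mul_zpow_neg_three_lt_one hq0 h13 h24
  set G : ℕ → ℕ → ℝ → ℂ := fun k j x => chi q (t₁ * (q : ℂ) ^ k) x * chi q (t₂ * (q : ℂ) ^ j) x *
    chi q t₃ x * chi q t₄ x with hG
  have hGi (k j : ℕ) : Integrable (G k j) μ :=
    (phiCoeff_mul_phiCoeff_mul_integral hq0 hq1 hμ h13 h24 m n k j).1
  refine ⟨(finite_poles hq0 m t₁).union (finite_poles hq0 n t₂),
    fun x => ∑ k ∈ Finset.range (m + 1), ∑ j ∈ Finset.range (n + 1),
      phiCoeff q m t₁ t₂ t₃ t₄ k * phiCoeff q n t₂ t₁ t₃ t₄ j * G k j x, ?_, ?_, ?_, ?_⟩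
  · have h := continuous_chi hq0 hq1
    exact continuous_finsetSum _ fun k _ => continuous_finsetSum _ fun j _ =>
      ((((h _).mul (h _)).mul (h t₃)).mul (h t₄)).const_mul _
  · intro x hx
    rw [Set.mem_union, not_or] at hx
    beta_reduce
    rw [show phi4 q m t₁ t₂ t₃ t₄ x * phi4 q n t₂ t₁ t₃ t₄ x *
        (chi q t₁ x * chi q t₂ x * chi q t₃ x * chi q t₄ x) =
      (phi4 q m t₁ t₂ t₃ t₄ x * chi q t₁ x) * (phi4 q n t₂ t₁ t₃ t₄ x * chi q t₂ x) *
        (chi q t₃ x * chi q t₄ x) by ring, phi4_mul_chi hq0 hq1 _ _ _ _ _ hx.1,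
      phi4_mul_chi hq0 hq1 _ _ _ _ _ hx.2, Finset.sum_mul_sum, Finset.sum_mul]
    refine Finset.sum_congr rfl fun k _ => ?_
    rw [Finset.sum_mul]
    exact Finset.sum_congr rfl fun j _ => by simp only [hG]; ring
  · exact integrable_finsetSum _ fun k _ => integrable_finsetSum _ fun j _ =>
      (hGi k j).const_mul _
  · rw [integral_finsetSum _ fun k _ => integrable_finsetSum _ fun j _ => (hGi k j).const_mul _]
    simp only [integral_finsetSum _ fun j _ => (hGi _ j).const_mul _, integral_const_mul]
    simp only [hG, (phiCoeff_mul_phiCoeff_mul_integral hq0 hq1 hμ h13 h24 m n _ _).2,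
      ← Finset.mul_sum]
    rw [← biorthSum]
    have hTn := fun n => qPoch_ne_zero hT hn1.le n
    split_ifs with hmn
    · subst hmn
      rw [biorthSum_self hq hn1 hn hTn, normConst]
      simp only [neg_mul]
      ring
    · rw [biorthSum_eq_zero hq hn1 hn hTn _ hmn, mul_zero]

/-! ### The special case `t₃ = t₄ = 0` and the forms of the constant -/

theorem phi4_zero_zero (q : ℝ) (n : ℕ) (t₁ t₂ : ℂ) (x : ℝ) :
    phi4 q n t₁ t₂ 0 0 x = phi3 q n t₁ t₂ x := by
  simp [phi4, phi3, basicHypergeometric]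

theorem chi_zero (q : ℝ) (x : ℝ) : chi q 0 x = 1 := by simp [chi]

theorem hasExtendedIntegral_phi3 {q : ℝ} (hq0 : 0 < q) (hq1 : q < 1) {μ : Measure ℝ}
    (hμ : IsMomentSolution q μ) (t₁ t₂ : ℂ) (m n : ℕ) :
    HasExtendedIntegral μ (poles q m t₁ ∪ poles q n t₂)
      (fun x => phi3 q m t₁ t₂ x * phi3 q n t₂ t₁ x * (chi q t₁ x * chi q t₂ x))
      (if m = n then normConst q n t₁ t₂ 0 0 else 0) := by
  have h : ‖(0 : ℂ)‖ < q ^ (3 / 2 : ℝ) := by rw [norm_zero]; positivity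
  simpa only [phi4_zero_zero, chi_zero, mul_one] using hasExtendedIntegral_phi4 hq0 hq1 hμ
    (t₁ := t₁) (t₂ := t₂) (t₃ := 0) (t₄ := 0) (by rwa [mul_zero]) (by rwa [mul_zero]) m n

/-- Both `(-u q^{n-2}; q)_n (-u q^{2n-1}; q)_∞` and `(-u q^{n-1}; q)_∞` arise
from `(-u q^{n-2}; q)_∞` by the removal of one factor. -/
theorem qPoch_mul_qPochInf_zpow {q : ℂ} (hq : q ≠ 0) (hq1 : ‖q‖ < 1) {u : ℂ} {n : ℕ}
    (h : 1 + u * q ^ (2 * (n : ℤ) - 2) ≠ 0) :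
    qPoch (-u * q ^ ((n : ℤ) - 2)) q n * qPochInf (-u * q ^ (2 * (n : ℤ) - 1)) q =
      (1 + u * q ^ ((n : ℤ) - 2)) / (1 + u * q ^ (2 * (n : ℤ) - 2)) *
        qPochInf (-u * q ^ ((n : ℤ) - 1)) q := by
  have e1 : -u * q ^ ((n : ℤ) - 2) * q = -u * q ^ ((n : ℤ) - 1) := by
    rw [mul_assoc, ← zpow_add_one₀ hq]; congr 2; ring
  have e2 : -u * q ^ ((n : ℤ) - 2) * q ^ n = -u * q ^ (2 * (n : ℤ) - 2) := by
    rw [mul_assoc, ← zpow_natCast q n, ← zpow_add₀ hq]; congr 2; ring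
  have e3 : -u * q ^ (2 * (n : ℤ) - 2) * q = -u * q ^ (2 * (n : ℤ) - 1) := by
    rw [mul_assoc, ← zpow_add_one₀ hq]; congr 2; ring
  have h1 := qPochInf_succ (-u * q ^ ((n : ℤ) - 2)) hq1
  have h2 := qPochInf_eq_qPoch_mul (-u * q ^ ((n : ℤ) - 2)) hq1 n
  rw [e2, qPochInf_succ (-u * q ^ (2 * (n : ℤ) - 2)) hq1, e3] at h2
  rw [e1] at h1
  rw [div_mul_eq_mul_div, eq_div_iff h]
  linear_combination h1 - h2

theorem normConst_eq {q : ℝ} (hq0 : 0 < q) (hq1 : q < 1) {t₁ t₂ t₃ t₄ : ℂ} {n : ℕ}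
    (h34 : t₃ * t₄ ≠ 0) (h : 1 + t₁ * t₂ * (q : ℂ) ^ (2 * (n : ℤ) - 2) ≠ 0) :
    normConst q n t₁ t₂ t₃ t₄ =
      (1 + t₁ * t₂ * (q : ℂ) ^ ((n : ℤ) - 2)) / (1 + t₁ * t₂ * (q : ℂ) ^ (2 * (n : ℤ) - 2)) *
      ((t₁ * t₂ * t₃ * t₄ * (q : ℂ) ^ (-3 : ℤ)) ^ n *
        (qPoch (q : ℂ) q n * qPoch (-(q : ℂ) ^ 2 / (t₃ * t₄)) q n) *
        qPochInf (-t₁ * t₂ * (q : ℂ) ^ ((n : ℤ) - 1)) q /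
        qPoch (t₁ * t₂ * t₃ * t₄ * (q : ℂ) ^ (-3 : ℤ)) q n) *
      (qPochInf (-t₁ * t₃ / q) q * qPochInf (-t₁ * t₄ / q) q * qPochInf (-t₂ * t₃ / q) q *
        qPochInf (-t₂ * t₄ / q) q * qPochInf (-t₃ * t₄ / q) q /
        qPochInf (t₁ * t₂ * t₃ * t₄ * (q : ℂ) ^ (-3 : ℤ)) q) := by
  have hq : (q : ℂ) ≠ 0 := by exact_mod_cast hq0.ne'
  have h1 := qPoch_mul_qPochInf_zpow hq (norm_ofReal_lt_one hq0 hq1) h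
  have h2 : ∏ k ∈ Finset.range n,
      (t₁ * t₂ * t₃ * t₄ * (q : ℂ) ^ (-3 : ℤ) + t₁ * t₂ * (q : ℂ) ^ ((k : ℤ) - 1)) =
      (t₁ * t₂ * t₃ * t₄ * (q : ℂ) ^ (-3 : ℤ)) ^ n * qPoch (-(q : ℂ) ^ 2 / (t₃ * t₄)) q n := by
    rw [qPoch, Finset.pow_eq_prod_const, ← Finset.prod_mul_distrib]
    refine Finset.prod_congr rfl fun k _ => ?_
    rw [zpow_sub_one₀ hq, zpow_natCast, show (-3 : ℤ) = -(3 : ℕ) from rfl, zpow_neg, zpow_natCast]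
    have h3 := left_ne_zero_of_mul h34
    have h4 := right_ne_zero_of_mul h34
    field_simp
    ring
  rw [normConst, h2]
  simp only [neg_mul] at h1 ⊢
  rw [mul_assoc (_ * _) (qPoch (-(t₁ * t₂ * _)) _ _) (qPochInf _ _), h1]
  ring

theorem normConst_zero_zero {q : ℝ} (hq0 : 0 < q) (hq1 : q < 1) {t₁ t₂ : ℂ} {n : ℕ}
    (h : 1 + t₁ * t₂ * (q : ℂ) ^ (2 * (n : ℤ) - 2) ≠ 0) :
    normConst q n t₁ t₂ 0 0 =
      (1 + t₁ * t₂ * (q : ℂ) ^ ((n : ℤ) - 2)) / (1 + t₁ * t₂ * (q : ℂ) ^ (2 * (n : ℤ) - 2)) *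
      qPochInf (-t₁ * t₂ * (q : ℂ) ^ ((n : ℤ) - 1)) q *
      qPoch (q : ℂ) q n * (q : ℂ) ^ ((n : ℤ) * ((n : ℤ) - 3) / 2) * (t₁ * t₂) ^ n := by
  have hq : (q : ℂ) ≠ 0 := by exact_mod_cast hq0.ne'
  have h1 := qPoch_mul_qPochInf_zpow hq (norm_ofReal_lt_one hq0 hq1) h
  have h2 (n : ℕ) : ∏ k ∈ Finset.range n, (t₁ * t₂ * (q : ℂ) ^ ((k : ℤ) - 1)) =
      (q : ℂ) ^ ((n : ℤ) * ((n : ℤ) - 3) / 2) * (t₁ * t₂) ^ n := by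
    induction n with
    | zero => simp
    | succ n ih =>
      have e : ((n + 1 : ℕ) : ℤ) * (((n + 1 : ℕ) : ℤ) - 3) / 2 =
          (n : ℤ) * ((n : ℤ) - 3) / 2 + ((n : ℤ) - 1) := by
        rw [show ((n + 1 : ℕ) : ℤ) * (((n + 1 : ℕ) : ℤ) - 3) =
          (n : ℤ) * ((n : ℤ) - 3) + ((n : ℤ) - 1) * 2 by push_cast; ring,
          Int.add_mul_ediv_right _ _ two_ne_zero]
      rw [Finset.prod_range_succ, ih, e, zpow_add₀ hq]
      ring
  rw [normConst]
  simp only [mul_zero, zero_mul, zero_div, zero_add, qPochInf_zero, qPoch_zero_left, mul_one,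
    div_one, h2]
  simp only [neg_mul] at h1 ⊢
  rw [mul_assoc (_ * _) (qPoch (-(t₁ * t₂ * _)) _ _) (qPochInf _ _), h1]
  ring

end QInvHermite
end

theorem mainTheorem8 (q : ℝ) (hq0 : 0 < q) (hq1 : q < 1) (μ : MeasureTheory.Measure ℝ)
    (hμ : QInvHermite.IsMomentSolution q μ) :
    -- biorthogonality of the `₄φ₃` rational functions
    (∀ t₁ t₂ t₃ t₄ : ℂ, ‖t₁ * t₃‖ < q ^ (3 / 2 : ℝ) → ‖t₂ * t₄‖ < q ^ (3 / 2 : ℝ) →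
      (∀ m n : ℕ,
        QInvHermite.HasExtendedIntegral μ
          (QInvHermite.poles q m t₁ ∪ QInvHermite.poles q n t₂)
          (fun x => QInvHermite.phi4 q m t₁ t₂ t₃ t₄ x * QInvHermite.phi4 q n t₂ t₁ t₃ t₄ x *
            (QInvHermite.chi q t₁ x * QInvHermite.chi q t₂ x *
              QInvHermite.chi q t₃ x * QInvHermite.chi q t₄ x))
          (if m = n then QInvHermite.normConst q n t₁ t₂ t₃ t₄ else 0)) ∧
      -- the classical form of the constant, where it makes sense
      (∀ n : ℕ, t₃ * t₄ ≠ 0 → 1 + t₁ * t₂ * (q : ℂ) ^ (2 * (n : ℤ) - 2) ≠ 0 →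
        QInvHermite.normConst q n t₁ t₂ t₃ t₄ =
          (1 + t₁ * t₂ * (q : ℂ) ^ ((n : ℤ) - 2)) / (1 + t₁ * t₂ * (q : ℂ) ^ (2 * (n : ℤ) - 2)) *
          ((t₁ * t₂ * t₃ * t₄ * (q : ℂ) ^ (-3 : ℤ)) ^ n *
            (QInvHermite.qPoch (q : ℂ) q n *
              QInvHermite.qPoch (-(q : ℂ) ^ 2 / (t₃ * t₄)) q n) *
            QInvHermite.qPochInf (-t₁ * t₂ * (q : ℂ) ^ ((n : ℤ) - 1)) q /
            QInvHermite.qPoch (t₁ * t₂ * t₃ * t₄ * (q : ℂ) ^ (-3 : ℤ)) q n) *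
          (QInvHermite.qPochInf (-t₁ * t₃ / q) q * QInvHermite.qPochInf (-t₁ * t₄ / q) q *
            QInvHermite.qPochInf (-t₂ * t₃ / q) q * QInvHermite.qPochInf (-t₂ * t₄ / q) q *
            QInvHermite.qPochInf (-t₃ * t₄ / q) q /
            QInvHermite.qPochInf (t₁ * t₂ * t₃ * t₄ * (q : ℂ) ^ (-3 : ℤ)) q))) ∧
    -- the special case `t₃ = t₄ = 0`
    (∀ t₁ t₂ : ℂ,
      (∀ (n : ℕ) (x : ℝ),
        QInvHermite.phi4 q n t₁ t₂ 0 0 x = QInvHermite.phi3 q n t₁ t₂ x) ∧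
      (∀ m n : ℕ,
        QInvHermite.HasExtendedIntegral μ
          (QInvHermite.poles q m t₁ ∪ QInvHermite.poles q n t₂)
          (fun x => QInvHermite.phi3 q m t₁ t₂ x * QInvHermite.phi3 q n t₂ t₁ x *
            (QInvHermite.chi q t₁ x * QInvHermite.chi q t₂ x))
          (if m = n then QInvHermite.normConst q n t₁ t₂ 0 0 else 0)) ∧
      (∀ n : ℕ, 1 + t₁ * t₂ * (q : ℂ) ^ (2 * (n : ℤ) - 2) ≠ 0 →
        QInvHermite.normConst q n t₁ t₂ 0 0 =
          (1 + t₁ * t₂ * (q : ℂ) ^ ((n : ℤ) - 2)) / (1 + t₁ * t₂ * (q : ℂ) ^ (2 * (n : ℤ) - 2)) *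
          QInvHermite.qPochInf (-t₁ * t₂ * (q : ℂ) ^ ((n : ℤ) - 1)) q *
          QInvHermite.qPoch (q : ℂ) q n * (q : ℂ) ^ ((n : ℤ) * ((n : ℤ) - 3) / 2) *
          (t₁ * t₂) ^ n)) := by
  exact ⟨fun t₁ t₂ t₃ t₄ h13 h24 =>
      ⟨QInvHermite.hasExtendedIntegral_phi4 hq0 hq1 hμ h13 h24,
        fun n h34 h => QInvHermite.normConst_eq hq0 hq1 h34 h⟩,
    fun t₁ t₂ => ⟨fun n x => QInvHermite.phi4_zero_zero q n t₁ t₂ x,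
      QInvHermite.hasExtendedIntegral_phi3 hq0 hq1 hμ t₁ t₂,
      fun n h => QInvHermite.normConst_zero_zero hq0 hq1 h⟩⟩
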